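/- Consider the strict-feedback system $$\dot x_i=x_{i+1}+\varphi_i(\bar x_i)^T\theta\ (1\le i\le n-1),\qquad \dot x_n=u+\varphi_n(x)^T\theta,\qquad y=x_1,$$ where $n\ge1$, $x=(x_1,\dots,x_n)$, $\bar x_i=(x_1,\dots,x_i)$, $\theta\in\mathbb R^p$ is constant and $\varphi_i:\mathbb R^i\to\mathbb R^p$ are smooth. Let $r:[0,\infty)\to\mathbb R$ be bounded together with its first $n$ derivatives, with $r^{(n)}$ piecewise continuous (so $r\in C^{n-1}$, and $r^{(n)}$ exists off a locally finite set). Let $\hat\theta$ be a locally absolutely continuous estimate of $\theta$, $\tilde\theta=\theta-\hat\theta$, and let $c_i,\kappa_i,g_i>0$ $(1\le i\le n)$. Define recursively, with $|\cdot|$ the Euclidean norm, $\alpha_0=0$ and, for $i=1,\dots,n$, $$h_i=x_i-\alpha_{i-1}-r^{(i-1)},\qquad w_i=\varphi_i-\sum_{j=1}^{i-1}\frac{\partial\alpha_{i-1}}{\partial x_j}\varphi_j,\qquad s_i=c_i+\kappa_i|w_i|^2+g_i\Big|\frac{\partial\alpha_{i-1}}{\partial\hat\theta}\Big|^2,$$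 $$\alpha_i=-s_ih_i-w_i^T\hat\theta+\sum_{k=1}^{i-1}\Big(\frac{\partial\alpha_{i-1}}{\partial x_k}x_{k+1}+\frac{\partial\alpha_{i-1}}{\partial r^{(k-1)}}r^{(k)}\Big),$$ and the override controller $\bar u=\alpha_n+r^{(n)}$. For $1\le i\le n-1$ put $$\underline c_i=-h_i(0)^{-1}\,b_i,\qquad b_i=\Big[x_{i+1}-r^{(i)}+w_i^T\hat\theta-\sum_{j=1}^{i-1}\Big(\frac{\partial\alpha_{i-1}}{\partial x_j}x_{j+1}+\frac{\partial\alpha_{i-1}}{\partial r^{(j-1)}}r^{(j)}\Big)\Big]_{t=0},$$ where, if $h_i(0)=0$, $\underline c_i$ is read as $-\infty$ when $b_i\ge0$ and as $+\infty$ when $b_i<0$. Let $\underline c=\min_{1\le i\le n}c_i$, $\underline\kappa=\min_{1\le i\le n}\kappa_i$, $\underline g=\min_{2\le i\le n}g_i$. Let $0<t_f\le\infty$ and suppose that a solution $x$ of the closed-loop system with $u=\bar u$ (locally absolutely continuous, the equations holding almost everywhere) is defined on $[0,t_f)$. Suppose that $c_i\ge\max\{\underline c_i,0\}$ for $i=1,\dots,n-1$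 and that $y(0)\ge r(0)$. Below, $\|\cdot\|_\infty$ and $\|\cdot\|_2$ are the $L_\infty$ and $L_2$ norms on $[0,t_f)$; the factor $\frac{\underline c^n-1}{\underline c^{n-1}(\underline c-1)}$ is read as $n$ if $\underline c=1$; and for $n=1$ the terms containing $\underline g$ are omitted. (i) If $\tilde\theta,\dot{\hat\theta}\in L_\infty[0,t_f)$, then $h=(h_1,\dots,h_n)$ and $x$ are bounded on $[0,t_f)$ and, for all $t\in[0,t_f)$, $$-h_1^*\le h_1(t)\le e^{-\underline ct}\sum_{i=1}^n\frac{t^{i-1}}{(i-1)!}h_i(0)+h_1^*,\qquad(\ast)$$ where $$h_1^*=\frac{\underline c^{n}-1}{\underline c^{n-1}(\underline c-1)}\left(\frac{\|\tilde\theta\|_\infty}{2\sqrt{\underline c\,\underline\kappa}}+\frac{\|\dot{\hat\theta}\|_\infty}{2\sqrt{\underline c\,\underline g}}\right).$$ (ii) If $\tilde\theta\in L_\infty[0,t_f)$ and $\dot{\hat\theta}\in L_2[0,t_f)$, then $h$ and $x$ are bounded on $[0,t_f)$ and $(\ast)$ holds with $$h_1^*=\frac{\underline c^{n}-1}{\underline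 c^{n-1}(\underline c-1)}\left(\frac{\|\tilde\theta\|_\infty}{2\sqrt{\underline c\,\underline\kappa}}+\frac{\|\dot{\hat\theta}\|_2}{\sqrt{2\underline g}}\right).$$ -/

import Mathlib

open MeasureTheory Set Filter Topology
open scoped ContDiff ENNReal

noncomputable section

namespace Nonovershooting

/-! Indices are 0-based: for `i : Fin n`, the coordinate `x i`, the regressor `φ i` and the gains
`c i`, `κ i`, `g i` are those which are customarily numbered `i + 1`. The virtual controls are
`α 0 = 0, α 1, …, α n`, indexed by `Fin (n + 1)`, so `α i.castSucc` is the virtual control that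
enters the error variable built from `x i`, and `α i.succ` is the next one. -/

/-- A point `(x, θ̂, ρ)`: plant state, parameter estimate, and the vector
`ρ = (r, r', …, r^(n-1))` of values of the reference and its derivatives. -/
abbrev Pt (n p : ℕ) : Type :=
  EuclideanSpace ℝ (Fin n) × EuclideanSpace ℝ (Fin p) × EuclideanSpace ℝ (Fin n)

variable {n p : ℕ}

/-- The truncated state consisting of the first `i + 1` coordinates of `x`. -/
def trunc (x : EuclideanSpace ℝ (Fin n)) (i : Fin n) : EuclideanSpace ℝ (Fin (i + 1)) :=
  WithLp.toLp 2 fun j => x (Fin.castLE i.isLt j)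

/-- The partial derivative `∂a/∂x_k`. -/
def partialX (a : Pt n p → ℝ) (k : Fin n) (z : Pt n p) : ℝ :=
  lineDeriv ℝ a z (EuclideanSpace.single k 1, 0, 0)

/-- The gradient `∂a/∂θ̂`. -/
def gradTheta (a : Pt n p → ℝ) (z : Pt n p) : EuclideanSpace ℝ (Fin p) :=
  WithLp.toLp 2 fun j => lineDeriv ℝ a z (0, EuclideanSpace.single j 1, 0)

/-- The partial derivative `∂a/∂r^(k)`. -/
def partialR (a : Pt n p → ℝ) (k : Fin n) (z : Pt n p) : ℝ :=
  lineDeriv ℝ a z (0, 0, EuclideanSpace.single k 1)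

/-- The error variable `x_i - a - r^(i)` for the virtual control `a`. -/
def errOf (i : Fin n) (a : Pt n p → ℝ) (z : Pt n p) : ℝ :=
  z.1 i - a z - z.2.2 i

/-- The vector `φ_i - ∑_{j < i} (∂a/∂x_j) φ_j` for the virtual control `a`. -/
def regOf (φ : (i : Fin n) → EuclideanSpace ℝ (Fin (i + 1)) → EuclideanSpace ℝ (Fin p))
    (i : Fin n) (a : Pt n p → ℝ) (z : Pt n p) : EuclideanSpace ℝ (Fin p) :=
  φ i (trunc z.1 i) -
    ∑ j ∈ Finset.univ.filter (fun j : Fin n => j < i), partialX a j z • φ j (trunc z.1 j)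

/-- The nonlinear damping coefficient `c_i + κ_i |w_i|² + g_i |∂a/∂θ̂|²`. -/
def dampOf (φ : (i : Fin n) → EuclideanSpace ℝ (Fin (i + 1)) → EuclideanSpace ℝ (Fin p))
    (c κ g : Fin n → ℝ) (i : Fin n) (a : Pt n p → ℝ) (z : Pt n p) : ℝ :=
  c i + κ i * ‖regOf φ i a z‖ ^ 2 + g i * ‖gradTheta a z‖ ^ 2

/-- The sum `∑_{k < i} ((∂a/∂x_k) x_{k+1} + (∂a/∂r^(k)) r^(k+1))`. -/
def driftOf (i : Fin n) (a : Pt n p → ℝ) (z : Pt n p) : ℝ :=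
  ∑ k : Fin i,
    (partialX a ⟨k, by omega⟩ z * z.1 ⟨k + 1, by omega⟩ +
      partialR a ⟨k, by omega⟩ z * z.2.2 ⟨k + 1, by omega⟩)

/-- The virtual controls `α 0, …, α n`, defined recursively by `α 0 = 0` and
`α (i+1) = - s_i h_i - w_iᵀ θ̂ + ∑_{k < i} ((∂α_i/∂x_k) x_{k+1} + (∂α_i/∂r^(k)) r^(k+1))`. -/
def virtualControl
    (φ : (i : Fin n) → EuclideanSpace ℝ (Fin (i + 1)) → EuclideanSpace ℝ (Fin p))
    (c κ g : Fin n → ℝ) : Fin (n + 1) → Pt n p → ℝ :=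
  Fin.induction (motive := fun _ => Pt n p → ℝ) (fun _ => 0) fun i a z =>
    -(dampOf φ c κ g i a z * errOf i a z) - inner ℝ (regOf φ i a z) z.2.1 + driftOf i a z

/-- The vector `h` of error variables at a point. -/
def err (φ : (i : Fin n) → EuclideanSpace ℝ (Fin (i + 1)) → EuclideanSpace ℝ (Fin p))
    (c κ g : Fin n → ℝ) (z : Pt n p) : EuclideanSpace ℝ (Fin n) :=
  WithLp.toLp 2 fun i => errOf i (virtualControl φ c κ g i.castSucc) z

/-- The override control `ū = α_n + r^(n)`; the value `rn` of `r^(n)` is the last argument. -/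
def overrideControl
    (φ : (i : Fin n) → EuclideanSpace ℝ (Fin (i + 1)) → EuclideanSpace ℝ (Fin p))
    (c κ g : Fin n → ℝ) (z : Pt n p) (rn : ℝ) : ℝ :=
  virtualControl φ c κ g (Fin.last n) z + rn

/-- The bracket
`x_{i+1} - r^(i+1) + w_iᵀ θ̂ - ∑_{j < i} ((∂α_i/∂x_j) x_{j+1} + (∂α_i/∂r^(j)) r^(j+1))`
in the lower bound for the gain `c_i`. -/
def gainBracket (φ : (i : Fin n) → EuclideanSpace ℝ (Fin (i + 1)) → EuclideanSpace ℝ (Fin p))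
    (c κ g : Fin n → ℝ) (z : Pt n p) (i : Fin n) (hi : (i : ℕ) + 1 < n) : ℝ :=
  z.1 ⟨i + 1, hi⟩ - z.2.2 ⟨i + 1, hi⟩
    + inner ℝ (regOf φ i (virtualControl φ c κ g i.castSucc) z) z.2.1
    - driftOf i (virtualControl φ c κ g i.castSucc) z

open Classical in
/-- The lower bound `- h_i⁻¹ * bracket` for the gain `c_i`, evaluated at the initial point `z`.
If `h_i = 0`, the gain has no influence on the next error variable, which then equals the bracket:
no gain is admissible (`⊤`) if the bracket is negative, and there is no restriction (`⊥`)
otherwise. -/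
def gainLower (φ : (i : Fin n) → EuclideanSpace ℝ (Fin (i + 1)) → EuclideanSpace ℝ (Fin p))
    (c κ g : Fin n → ℝ) (z : Pt n p) (i : Fin n) (hi : (i : ℕ) + 1 < n) : EReal :=
  if err φ c κ g z i = 0 then
    (if gainBracket φ c κ g z i hi < 0 then ⊤ else ⊥)
  else ((-(err φ c κ g z i)⁻¹ * gainBracket φ c κ g z i hi : ℝ) : EReal)

/-- The `k`-th derivative of `r` on `[0, ∞)` (one-sided at `0`). -/
def refDeriv (r : ℝ → ℝ) (k : ℕ) (t : ℝ) : ℝ :=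
  iteratedDerivWithin k r (Ici 0) t

/-- Piecewise continuity on `[0, ∞)`, with `S` containing the exceptional points: finitely many in
every bounded interval, with one-sided limits at each of them. -/
def PiecewiseContinuousOff (f : ℝ → ℝ) (S : Set ℝ) : Prop :=
  (∀ T : ℝ, (S ∩ Icc 0 T).Finite) ∧
  (∀ t ∈ Ici (0 : ℝ) \ S, ContinuousWithinAt f (Ici 0) t) ∧
  (∀ t ∈ S, 0 ≤ t → ∃ L, Tendsto f (𝓝[>] t) (𝓝 L)) ∧
  (∀ t ∈ S, 0 < t → ∃ L, Tendsto f (𝓝[<] t) (𝓝 L))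

/-- The standing assumption on the safety boundary `r`: on `[0, ∞)` it is `C^(n-1)`, its `n`-th
derivative exists off a locally finite set and is piecewise continuous, and
`r, r', …, r^(n)` are bounded. -/
structure IsReference (n : ℕ) (r : ℝ → ℝ) : Prop where
  contDiffOn : ContDiffOn ℝ ((n - 1 : ℕ) : WithTop ℕ∞) r (Ici 0)
  piecewise : ∃ S : Set ℝ, PiecewiseContinuousOff (refDeriv r n) S ∧
    ∀ t ∈ Ici (0 : ℝ) \ S, DifferentiableWithinAt ℝ (refDeriv r (n - 1)) (Ici 0) t
  bounded : ∃ M : ℝ, ∀ k ≤ n, ∀ t : ℝ, 0 ≤ t → |refDeriv r k t| ≤ M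

/-- The time interval `[0, t_f)`, where `t_f` may be `∞`. -/
def timeInterval (tf : EReal) : Set ℝ := {t : ℝ | 0 ≤ t ∧ (t : EReal) < tf}

/-- The point `(x(t), θ̂(t), r(t), …, r^(n-1)(t))`. -/
def ptAt (r : ℝ → ℝ) (x : ℝ → EuclideanSpace ℝ (Fin n)) (θhat : ℝ → EuclideanSpace ℝ (Fin p))
    (t : ℝ) : Pt n p :=
  (x t, θhat t, WithLp.toLp 2 fun k : Fin n => refDeriv r k t)

/-- On `[0, t_f)`, `x` is a solution (in the sense of Carathéodory) of the strict-feedback plant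
`x_i' = x_{i+1} + φ_i(x_1, …, x_i)ᵀ θ`, `x_n' = u + φ_n(x)ᵀ θ` under the override control `u = ū`
computed from the parameter estimate `θhat`, which is locally absolutely continuous. -/
structure IsClosedLoop
    (φ : (i : Fin n) → EuclideanSpace ℝ (Fin (i + 1)) → EuclideanSpace ℝ (Fin p))
    (c κ g : Fin n → ℝ) (r : ℝ → ℝ) (θ : EuclideanSpace ℝ (Fin p)) (tf : EReal)
    (x : ℝ → EuclideanSpace ℝ (Fin n)) (θhat : ℝ → EuclideanSpace ℝ (Fin p)) : Prop where
  x_ac : ∀ T ∈ timeInterval tf, AbsolutelyContinuousOnInterval x 0 T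
  θhat_ac : ∀ T ∈ timeInterval tf, AbsolutelyContinuousOnInterval θhat 0 T
  dynamics : ∀ᵐ t ∂(volume.restrict (timeInterval tf)), ∀ i : Fin n,
    HasDerivAt (fun s => x s i)
      ((if hi : (i : ℕ) + 1 < n then x t ⟨i + 1, hi⟩
        else overrideControl φ c κ g (ptAt r x θhat t) (refDeriv r n t))
        + inner ℝ (φ i (trunc (x t) i)) θ) t

/-- The `L_q` norm of a signal on `[0, t_f)`. -/
def sigNorm (q : ℝ≥0∞) (tf : EReal) (v : ℝ → EuclideanSpace ℝ (Fin p)) : ℝ :=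
  (eLpNorm v q (volume.restrict (timeInterval tf))).toReal

/-- The factor `(c^n - 1) / (c^(n-1) (c - 1))`, with its continuous extension `n` at `c = 1`. -/
def geomFactor (n : ℕ) (c : ℝ) : ℝ :=
  if c = 1 then n else (c ^ n - 1) / (c ^ (n - 1) * (c - 1))

/-- `min_{i ≥ 2} g_i` (1-based numbering). It is used only if `n ≥ 2`. -/
def minTail (g : Fin n → ℝ) : ℝ := ⨅ i : {i : Fin n // 0 < (i : ℕ)}, g i

/-- The violation bound in terms of the norms `a = ‖θ̃‖_∞` and `b = ‖θ̂'‖_∞`. For `n = 1` the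
minimum of the `g_i`, `i ≥ 2`, is over the empty set and the second term is absent. -/
def violationInf (c κ g : Fin n → ℝ) (a b : ℝ) : ℝ :=
  geomFactor n (⨅ i, c i) *
    (a / (2 * √((⨅ i, c i) * ⨅ i, κ i)) +
      if n = 1 then 0 else b / (2 * √((⨅ i, c i) * minTail g)))

/-- The violation bound in terms of the norms `a = ‖θ̃‖_∞` and `b = ‖θ̂'‖_2`, with the same
convention for `n = 1`. -/
def violationTwo (c κ g : Fin n → ℝ) (a b : ℝ) : ℝ :=
  geomFactor n (⨅ i, c i) *
    (a / (2 * √((⨅ i, c i) * ⨅ i, κ i)) +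
      if n = 1 then 0 else b / √(2 * minTail g))

/-- The common conclusion for error and plant trajectories `h`, `x` on `[0, t_f)`: both are bounded
and `-H ≤ h_1(t) ≤ e^(-c̲ t) ∑_i t^(i-1)/(i-1)! h_i(0) + H`, where `c̲ = min_i c_i`. -/
def SafeBound (hn : 1 ≤ n) (c : Fin n → ℝ) (tf : EReal)
    (h x : ℝ → EuclideanSpace ℝ (Fin n)) (H : ℝ) : Prop :=
  (∃ M : ℝ, ∀ t ∈ timeInterval tf, ‖h t‖ ≤ M) ∧
  (∃ M : ℝ, ∀ t ∈ timeInterval tf, ‖x t‖ ≤ M) ∧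
  ∀ t ∈ timeInterval tf,
    -H ≤ h t ⟨0, hn⟩ ∧
    h t ⟨0, hn⟩ ≤
      Real.exp (-(⨅ i, c i) * t) * ∑ i : Fin n, t ^ (i : ℕ) / ((i : ℕ).factorial : ℝ) * h 0 i + H

end Nonovershooting

end

/-! In the error variables the closed loop is a cascade of damped scalar equations
`h_i' = h_{i+1} - s_i h_i + δ_i`, where `h_{n+1} = 0` and `δ_i = w_iᵀ θ̃ - (∂α_{i-1}/∂θ̂) θ̂'`,
because `α_{i-1}` depends only on `θ̂` and on the state and reference coordinates below `i`. The
conditions on the gains and on `y(0)` ensure `h_i(0) ≥ 0` for all `i`. Completing squares in `s_i`,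
one finds a function `η`, the same for all `i`, with `η' + s_i η ≥ |δ_i|`: a constant takes care of
a bounded signal, and the square root of a constant plus `∫₀ᵗ |θ̂'|² / (2 g̲)` of a square
integrable `θ̂'`. If `η ≤ D`, comparison down the cascade, from `h_{n+1} = 0` to `h_1`, bounds `h_1`
by the solution of the undisturbed cascade plus `D ∑_{k < n} c̲^{-k}`; the same comparison for `-h`
with zero initial data gives the lower bound. Boundedness of `x` follows by recursion from
`x_i = h_i + α_{i-1} + r^(i-1)`. -/

noncomputable section

namespace Nonovershooting

variable {n p : ℕ}

section AbsoluteContinuity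

variable {X Y : Type*} [PseudoMetricSpace X] [PseudoMetricSpace Y] {a b : ℝ}

theorem absolutelyContinuousOnInterval_comp_lipschitzOnWith {f : ℝ → X} {G : X → Y} {K : NNReal}
    (hf : AbsolutelyContinuousOnInterval f a b) (hG : LipschitzOnWith K G (f '' uIcc a b)) :
    AbsolutelyContinuousOnInterval (fun t => G (f t)) a b := by
  have h0 := Filter.Tendsto.const_mul (K : ℝ) hf
  rw [mul_zero] at h0
  refine squeeze_zero' (Eventually.of_forall fun E => Finset.sum_nonneg fun _ _ => dist_nonneg)
    ?_ h0
  filter_upwards [mem_inf_of_right (mem_principal_self _)] with E hE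
  rw [Finset.mul_sum]
  exact Finset.sum_le_sum fun i hi => hG.dist_le_mul _ (mem_image_of_mem f (hE.1 i hi).1) _
    (mem_image_of_mem f (hE.1 i hi).2)

theorem absolutelyContinuousOnInterval_prodMk {f : ℝ → X} {f' : ℝ → Y}
    (hf : AbsolutelyContinuousOnInterval f a b) (hf' : AbsolutelyContinuousOnInterval f' a b) :
    AbsolutelyContinuousOnInterval (fun t => (f t, f' t)) a b := by
  have h0 := Tendsto.add hf hf'
  rw [add_zero] at h0
  refine squeeze_zero (fun E => Finset.sum_nonneg fun _ _ => dist_nonneg) (fun E => ?_) h0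
  rw [← Finset.sum_add_distrib]
  exact Finset.sum_le_sum fun i _ =>
    max_le (le_add_of_nonneg_right dist_nonneg) (le_add_of_nonneg_left dist_nonneg)

theorem absolutelyContinuousOnInterval_comp_contDiffAt {E F : Type*} [NormedAddCommGroup E]
    [NormedSpace ℝ E] [NormedAddCommGroup F] [NormedSpace ℝ F] {f : ℝ → E} {G : E → F}
    (hf : AbsolutelyContinuousOnInterval f a b)
    (hG : ∀ t ∈ uIcc a b, ContDiffAt ℝ 1 G (f t)) :
    AbsolutelyContinuousOnInterval (fun t => G (f t)) a b := by
  have hloc : LocallyLipschitzOn (f '' uIcc a b) G := by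
    rintro _ ⟨t, ht, rfl⟩
    obtain ⟨K, u, hu, hK⟩ := (hG t ht).exists_lipschitzOnWith
    exact ⟨K, u, mem_nhdsWithin_of_mem_nhds hu, hK⟩
  obtain ⟨K, hK⟩ := hloc.exists_lipschitzOnWith_of_compact
    (isCompact_uIcc.image_of_continuousOn hf.continuousOn)
  exact absolutelyContinuousOnInterval_comp_lipschitzOnWith hf hK

theorem hasDerivAt_of_coord {ι : Type*} [Fintype ι] {f : ℝ → EuclideanSpace ℝ ι}
    {f' : EuclideanSpace ℝ ι} {t : ℝ} (h : ∀ j, HasDerivAt (fun s => f s j) (f' j) t) :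
    HasDerivAt f f' t :=
  (PiLp.continuousLinearEquiv 2 ℝ fun _ : ι => ℝ).symm.hasFDerivAt.comp_hasDerivAt t
    (hasDerivAt_pi.2 h)

theorem ae_hasDerivAt_of_absolutelyContinuousOnInterval {ι : Type*} [Fintype ι]
    {f : ℝ → EuclideanSpace ℝ ι} (hf : AbsolutelyContinuousOnInterval f a b) :
    ∀ᵐ t, t ∈ uIcc a b → HasDerivAt f (deriv f t) t := by
  have hc : ∀ j, ∀ᵐ t, t ∈ uIcc a b → DifferentiableAt ℝ (fun t => f t j) t := fun j =>
    (absolutelyContinuousOnInterval_comp_contDiffAt hf fun _ _ =>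
      (contDiff_euclidean.1 contDiff_id j).contDiffAt).ae_differentiableAt
  filter_upwards [ae_all_iff.2 hc] with t ht hm
  exact (differentiableAt_euclidean.2 fun j => ht j hm).hasDerivAt

theorem le_of_ae_deriv_le_of_lt {f g : ℝ → ℝ} (hf : AbsolutelyContinuousOnInterval f a b)
    (hg : AbsolutelyContinuousOnInterval g a b) (h0 : f a ≤ g a)
    (h : ∀ᵐ t, t ∈ Icc a b → g t < f t → deriv f t ≤ deriv g t) :
    ∀ t ∈ Icc a b, f t ≤ g t := by
  intro t ht
  by_contra! hlt
  have hsub : Icc a t ⊆ uIcc a b := (Icc_subset_Icc_right ht.2).trans Icc_subset_uIcc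
  obtain ⟨τ, ⟨hτ, hτle⟩, hτmax⟩ : ∃ τ, IsGreatest {s ∈ Icc a t | f s ≤ g s} τ :=
    (isCompact_Icc.of_isClosed_subset
      (isClosed_Icc.isClosed_le (hf.continuousOn.mono hsub) (hg.continuousOn.mono hsub))
      (sep_subset _ _)).exists_isGreatest ⟨a, left_mem_Icc.2 ht.1, h0⟩
  have hsub' : uIcc τ t ⊆ uIcc a b := by
    rw [uIcc_of_le hτ.2]
    exact (Icc_subset_Icc_left hτ.1).trans hsub
  have hf' := hf.mono hsub'
  have hg' := hg.mono hsub'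
  have hderiv : ∀ᵐ s, s ∈ Ioc τ t → deriv f s ≤ deriv g s := by
    filter_upwards [h] with s hs hm
    have has : a ≤ s := hτ.1.trans hm.1.le
    refine hs ⟨has, hm.2.trans ht.2⟩ (not_le.1 fun hle => ?_)
    exact hm.1.not_ge (hτmax ⟨⟨has, hm.2⟩, hle⟩)
  have hmono : ∫ s in τ..t, deriv f s ≤ ∫ s in τ..t, deriv g s := by
    refine intervalIntegral.integral_mono_ae_restrict hτ.2 hf'.intervalIntegrable_deriv
      hg'.intervalIntegrable_deriv ?_
    rwa [EventuallyLE, Measure.restrict_congr_set Ioc_ae_eq_Icc.symm,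
      ae_restrict_iff' measurableSet_Ioc]
  rw [hf'.integral_deriv_eq_sub, hg'.integral_deriv_eq_sub] at hmono
  linarith

end AbsoluteContinuity

section Envelope

variable {ι : Type*} {s δ δ₁ δ₂ : ι → ℝ → ℝ} {T D D₁ D₂ : ℝ} {y y₁ y₂ : ℝ → ℝ}

/-- An envelope, with values at most `D` on `[0, T]`, of the disturbances `δ i` acting on the damped
equations `h' = -s i * h + d`: a nonnegative start `y 0` and `y' ≥ -s i * y + δ i` for all `i` make
`y` a common barrier for all `d ≤ δ i`. -/
structure IsEnvelope (s δ : ι → ℝ → ℝ) (T D : ℝ) (y : ℝ → ℝ) : Prop where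
  absolutelyContinuous : AbsolutelyContinuousOnInterval y 0 T
  nonneg_zero : 0 ≤ y 0
  le : ∀ t ∈ Icc 0 T, y t ≤ D
  ae_le : ∀ᵐ t, t ∈ Icc 0 T → ∀ i, δ i t ≤ deriv y t + s i t * y t

theorem IsEnvelope.mono (h : IsEnvelope s δ₁ T D₁ y)
    (hδ : ∀ᵐ t, t ∈ Icc 0 T → ∀ i, δ₂ i t ≤ δ₁ i t) (hD : D₁ ≤ D₂) :
    IsEnvelope s δ₂ T D₂ y where
  absolutelyContinuous := h.absolutelyContinuous
  nonneg_zero := h.nonneg_zero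
  le t ht := (h.le t ht).trans hD
  ae_le := by
    filter_upwards [h.ae_le, hδ] with t hy hδ ht i
    exact (hδ ht i).trans (hy ht i)

theorem IsEnvelope.add (h₁ : IsEnvelope s δ₁ T D₁ y₁) (h₂ : IsEnvelope s δ₂ T D₂ y₂) :
    IsEnvelope s (fun i t => δ₁ i t + δ₂ i t) T (D₁ + D₂) fun t => y₁ t + y₂ t where
  absolutelyContinuous := h₁.absolutelyContinuous.add h₂.absolutelyContinuous
  nonneg_zero := add_nonneg h₁.nonneg_zero h₂.nonneg_zero
  le t ht := add_le_add (h₁.le t ht) (h₂.le t ht)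
  ae_le := by
    filter_upwards [h₁.ae_le, h₂.ae_le, h₁.absolutelyContinuous.ae_differentiableAt,
      h₂.absolutelyContinuous.ae_differentiableAt] with t hy₁ hy₂ hd₁ hd₂ ht i
    have hmem := Icc_subset_uIcc ht
    rw [deriv_fun_add (hd₁ hmem) (hd₂ hmem), mul_add]
    linarith [hy₁ ht i, hy₂ ht i]

theorem isEnvelope_const (hD : 0 ≤ D) (h : ∀ᵐ t, t ∈ Icc 0 T → ∀ i, δ i t ≤ D * s i t) :
    IsEnvelope s δ T D fun _ => D where
  absolutelyContinuous := contDiff_const.contDiffOn.absolutelyContinuousOnInterval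
  nonneg_zero := hD
  le _ _ := le_rfl
  ae_le := by simpa only [deriv_const, zero_add, mul_comm D] using h

theorem mul_le_div_add_mul {γ q β y : ℝ} (hγ : 0 < γ) (hy : 0 < y) :
    q * β ≤ β ^ 2 / (4 * γ * y) + γ * q ^ 2 * y := by
  have h := sq_nonneg (β - 2 * γ * y * q)
  rw [← sub_le_iff_le_add, le_div_iff₀ (by positivity)]
  linarith

-- Since `2 γ (y²)' = β²` for `y = √Y`, the derivative of `y` is the first term of the AM-GM bound.
theorem isEnvelope_sqrt {q : ι → ℝ → ℝ} {β Y : ℝ → ℝ} {γ : ℝ} (hγ : 0 < γ)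
    (hs : ∀ i t, γ * q i t ^ 2 ≤ s i t) (hYac : AbsolutelyContinuousOnInterval Y 0 T)
    (hYpos : ∀ t ∈ uIcc 0 T, 0 < Y t) (hD : 0 ≤ D) (hYD : ∀ t ∈ Icc 0 T, Y t ≤ D ^ 2)
    (hY : ∀ᵐ t, t ∈ Icc 0 T → HasDerivAt Y ((2 * γ)⁻¹ * β t ^ 2) t) :
    IsEnvelope s (fun i t => q i t * β t) T D fun t => √(Y t) where
  absolutelyContinuous := absolutelyContinuousOnInterval_comp_contDiffAt hYac fun t ht =>
    Real.contDiffAt_sqrt (hYpos t ht).ne'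
  nonneg_zero := Real.sqrt_nonneg _
  le t ht := Real.sqrt_le_iff.2 ⟨hD, hYD t ht⟩
  ae_le := by
    filter_upwards [hY] with t hYt ht i
    have hpos := hYpos t (Icc_subset_uIcc ht)
    have hsqrt := Real.sqrt_pos.2 hpos
    rw [((hYt ht).sqrt hpos.ne').deriv]
    calc q i t * β t ≤ β t ^ 2 / (4 * γ * √(Y t)) + γ * q i t ^ 2 * √(Y t) :=
          mul_le_div_add_mul hγ hsqrt
      _ ≤ (2 * γ)⁻¹ * β t ^ 2 / (2 * √(Y t)) + s i t * √(Y t) := by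
          refine add_le_add (le_of_eq ?_) (mul_le_mul_of_nonneg_right (hs i t) hsqrt.le)
          field_simp
          norm_num

theorem exists_isEnvelope_of_integral_sq_lt {q : ι → ℝ → ℝ} {β : ℝ → ℝ} {γ : ℝ} (hγ : 0 < γ)
    (hT : 0 ≤ T) (hs : ∀ i t, γ * q i t ^ 2 ≤ s i t)
    (hβ : IntervalIntegrable (fun t => β t ^ 2) volume 0 T) (hD : 0 ≤ D)
    (hβD : ∫ t in (0 : ℝ)..T, β t ^ 2 < 2 * γ * D ^ 2) :
    ∃ y, IsEnvelope s (fun i t => q i t * β t) T D y := by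
  have hF : ∀ t ∈ Icc 0 T, 0 ≤ ∫ v in t..T, β v ^ 2 := fun t ht =>
    intervalIntegral.integral_nonneg ht.2 fun _ _ => sq_nonneg _
  refine ⟨_, isEnvelope_sqrt (Y := fun t => D ^ 2 + (2 * γ)⁻¹ * ∫ v in T..t, β v ^ 2) hγ hs ?_
    (fun t ht => ?_) hD (fun t ht => ?_) ?_⟩
  · exact contDiff_const.contDiffOn.absolutelyContinuousOnInterval.add
      ((hβ.absolutelyContinuousOnInterval_intervalIntegral right_mem_uIcc).const_mul _)
  · rw [uIcc_of_le hT] at ht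
    have hle : ∫ v in t..T, β v ^ 2 ≤ ∫ v in (0 : ℝ)..T, β v ^ 2 :=
      intervalIntegral.integral_mono_interval ht.1 ht.2 le_rfl
        (Eventually.of_forall fun _ => sq_nonneg _) hβ
    rw [intervalIntegral.integral_symm, mul_neg, ← sub_eq_add_neg, sub_pos,
      inv_mul_lt_iff₀ (by positivity)]
    exact hle.trans_lt hβD
  · rw [intervalIntegral.integral_symm, mul_neg, ← sub_eq_add_neg]
    exact sub_le_self _ (mul_nonneg (by positivity) (hF t ht))
  · filter_upwards [hβ.ae_hasDerivAt_integral] with t hFt ht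
    exact ((hFt (Icc_subset_uIcc ht) T right_mem_uIcc).const_mul _).const_add _

end Envelope

section Cascade

/-- The nominal response of the error system: the component `U 0` of the solution of
`(U i)' = -c * U i + U (i + 1)`, `U i 0 = a i`, for `i < m`, where `U m = 0`. -/
def decay (c : ℝ) (a : ℕ → ℝ) (m : ℕ) (t : ℝ) : ℝ :=
  Real.exp (-c * t) * ∑ j ∈ Finset.range m, t ^ j / (j.factorial : ℝ) * a j

variable {c : ℝ} {a : ℕ → ℝ} {m : ℕ} {t T : ℝ}

theorem decay_nonneg (ha : ∀ j, 0 ≤ a j) (ht : 0 ≤ t) : 0 ≤ decay c a m t :=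
  mul_nonneg (Real.exp_pos _).le (Finset.sum_nonneg fun j _ => mul_nonneg (by positivity) (ha j))

theorem decay_succ_zero : decay c a (m + 1) 0 = a 0 := by
  simp [decay, Finset.sum_range_succ']

theorem hasDerivAt_pow_succ_div_factorial (j : ℕ) (t : ℝ) :
    HasDerivAt (fun u : ℝ => u ^ (j + 1) / ((j + 1).factorial : ℝ))
      (t ^ j / (j.factorial : ℝ)) t := by
  refine ((hasDerivAt_pow (j + 1) t).div_const _).congr_deriv ?_
  rw [Nat.factorial_succ]
  push_cast
  field_simp

theorem hasDerivAt_decay (c : ℝ) (a : ℕ → ℝ) (m : ℕ) (t : ℝ) :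
    HasDerivAt (decay c a (m + 1))
      (decay c (fun j => a (j + 1)) m t - c * decay c a (m + 1) t) t := by
  have hsum : HasDerivAt (fun u : ℝ => ∑ j ∈ Finset.range (m + 1), u ^ j / (j.factorial : ℝ) * a j)
      (∑ j ∈ Finset.range m, t ^ j / (j.factorial : ℝ) * a (j + 1)) t := by
    simp only [Finset.sum_range_succ', pow_zero]
    exact (HasDerivAt.fun_sum fun j _ =>
      (hasDerivAt_pow_succ_div_factorial j t).mul_const _).add_const _
  have hexp : HasDerivAt (fun u : ℝ => Real.exp (-c * u)) (Real.exp (-c * t) * -c) t := by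
    simpa using ((hasDerivAt_id t).const_mul (-c)).exp
  refine (hexp.mul hsum).congr_deriv ?_
  simp only [decay]
  ring

theorem contDiff_decay (c : ℝ) (a : ℕ → ℝ) (m : ℕ) : ContDiff ℝ 1 (decay c a m) := by
  unfold decay
  fun_prop

theorem exp_mul_pow_div_factorial_le (hc : 0 < c) (ht : 0 ≤ t) (j : ℕ) :
    Real.exp (-c * t) * (t ^ j / (j.factorial : ℝ)) ≤ c⁻¹ ^ j := by
  have h := Real.pow_div_factorial_le_exp (c * t) (by positivity) j
  rw [neg_mul, Real.exp_neg, inv_mul_le_iff₀ (Real.exp_pos _), inv_pow, ← div_eq_mul_inv,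
    le_div_iff₀ (by positivity)]
  rwa [mul_pow, mul_div_assoc, mul_comm] at h

theorem decay_le_sum (hc : 0 < c) (ha : ∀ j, 0 ≤ a j) (ht : 0 ≤ t) :
    decay c a m t ≤ ∑ j ∈ Finset.range m, c⁻¹ ^ j * a j := by
  rw [decay, Finset.mul_sum]
  refine Finset.sum_le_sum fun j _ => ?_
  rw [← mul_assoc]
  exact mul_le_mul_of_nonneg_right (exp_mul_pow_div_factorial_le hc ht j) (ha j)

theorem le_add_of_damped {f y U E : ℝ → ℝ} (hc : 0 ≤ c)
    (hf : AbsolutelyContinuousOnInterval f 0 T) (hy : AbsolutelyContinuousOnInterval y 0 T)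
    (hUac : AbsolutelyContinuousOnInterval U 0 T)
    (hU : ∀ t, HasDerivAt U (E t - c * U t) t) (hU0 : ∀ t ∈ Icc 0 T, 0 ≤ U t)
    (h0 : f 0 ≤ U 0 + y 0)
    (hder : ∀ᵐ t, t ∈ Icc 0 T → ∃ s ≥ c, deriv f t ≤ E t - s * (f t - y t) + deriv y t) :
    ∀ t ∈ Icc 0 T, f t ≤ U t + y t := by
  refine le_of_ae_deriv_le_of_lt hf (hUac.add hy) h0 ?_
  filter_upwards [hder, hy.ae_differentiableAt] with t hft hyt ht hlt
  obtain ⟨s, hs, hle⟩ := hft ht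
  have hdamp : c * U t ≤ s * (f t - y t) :=
    mul_le_mul hs (le_sub_iff_add_le.2 hlt.le) (hU0 t ht) (hc.trans hs)
  rw [((hU t).fun_add (hyt (Icc_subset_uIcc ht)).hasDerivAt).deriv]
  linarith

theorem cascade_le {D : ℝ} {y : ℝ → ℝ} (hc : 0 < c) (hD : 0 ≤ D)
    (hyac : AbsolutelyContinuousOnInterval y 0 T) (hy0 : 0 ≤ y 0)
    (hyD : ∀ t ∈ Icc 0 T, y t ≤ D) {h : ℕ → ℝ → ℝ} (ha : ∀ i, 0 ≤ a i)
    (hac : ∀ i < m, AbsolutelyContinuousOnInterval (h i) 0 T) (hh0 : ∀ i < m, h i 0 ≤ a i)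
    (hm : ∀ t ∈ Icc 0 T, h m t ≤ 0)
    (hder : ∀ i < m, ∀ᵐ t, t ∈ Icc 0 T →
      ∃ s ≥ c, deriv (h i) t ≤ h (i + 1) t - s * (h i t - y t) + deriv y t) :
    ∀ t ∈ Icc 0 T, h 0 t ≤ decay c a m t + D * ∑ k ∈ Finset.range m, c⁻¹ ^ k := by
  induction m generalizing h a with
  | zero => simpa [decay] using hm
  | succ m ih =>
    set a' : ℕ → ℝ := fun j => a (j + 1)
    set G := ∑ k ∈ Finset.range m, c⁻¹ ^ k with hG
    have hGsucc : ∑ k ∈ Finset.range (m + 1), c⁻¹ ^ k = c⁻¹ * G + 1 := by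
      simp only [Finset.sum_range_succ', pow_zero, pow_succ', ← Finset.mul_sum, hG]
    have hDG : 0 ≤ D * (c⁻¹ * G) := by
      have : 0 ≤ G := Finset.sum_nonneg fun _ _ => by positivity
      positivity
    have hnext : ∀ t ∈ Icc 0 T, h 1 t ≤ decay c a' m t + D * G :=
      ih (h := fun i => h (i + 1)) (fun i => ha (i + 1)) (fun i hi => hac (i + 1) (by omega))
        (fun i hi => hh0 (i + 1) (by omega)) hm fun i hi => hder (i + 1) (by omega)
    set U : ℝ → ℝ := fun t => decay c a (m + 1) t + D * (c⁻¹ * G)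
    have hU : ∀ t, HasDerivAt U (decay c a' m t + D * G - c * U t) t := fun t =>
      ((hasDerivAt_decay c a m t).add_const _).congr_deriv (by simp only [U, a']; field_simp; ring)
    have hUac : AbsolutelyContinuousOnInterval U 0 T :=
      ((contDiff_decay c a (m + 1)).add contDiff_const).contDiffOn.absolutelyContinuousOnInterval
    have hbarrier : ∀ t ∈ Icc 0 T, h 0 t ≤ U t + y t := by
      refine le_add_of_damped hc.le (hac 0 (by omega)) hyac hUac hU
        (fun t ht => add_nonneg (decay_nonneg ha ht.1) hDG) ?_ ?_
      · simp only [U, decay_succ_zero]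
        linarith [hh0 0 (by omega)]
      · filter_upwards [hder 0 (by omega)] with t hdt ht
        obtain ⟨s, hs, hle⟩ := hdt ht
        exact ⟨s, hs, hle.trans (by linarith [hnext t ht])⟩
    intro t ht
    rw [hGsucc]
    linarith [hbarrier t ht, hyD t ht]

theorem geomFactor_eq_sum (hm : 1 ≤ m) (hc : 0 < c) :
    geomFactor m c = ∑ k ∈ Finset.range m, c⁻¹ ^ k := by
  unfold geomFactor
  split_ifs with h
  · simp [h]
  · obtain ⟨k, rfl⟩ : ∃ k, m = k + 1 := ⟨m - 1, by omega⟩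
    have h_inv : c⁻¹ ≠ 1 := by simpa using h
    rw [geom_sum_eq h_inv, div_eq_div_iff
      (mul_ne_zero (by positivity) (sub_ne_zero.2 h)) (sub_ne_zero.2 h_inv)]
    simp only [Nat.add_sub_cancel, inv_pow, pow_succ]
    field_simp
    ring

end Cascade

section Differentiation

theorem contDiff_lineDeriv {E F : Type*} [NormedAddCommGroup E] [NormedSpace ℝ E]
    [NormedAddCommGroup F] [NormedSpace ℝ F] {a : E → F} (ha : ContDiff ℝ ∞ a) (v : E) :
    ContDiff ℝ ∞ fun z => lineDeriv ℝ a z v := by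
  have h_fderiv : (fun z => lineDeriv ℝ a z v) = fun z => fderiv ℝ a z v :=
    funext fun z => (ha.differentiable (by simp) z).lineDeriv_eq_fderiv
  rw [h_fderiv]
  exact (ha.fderiv_right (by simp)).clm_apply contDiff_const

theorem contDiff_state (k : Fin n) : ContDiff ℝ ∞ fun z : Pt n p => z.1 k :=
  contDiff_euclidean.1 contDiff_fst k

theorem contDiff_refValue (k : Fin n) : ContDiff ℝ ∞ fun z : Pt n p => z.2.2 k :=
  contDiff_euclidean.1 (contDiff_snd.comp contDiff_snd) k

variable {a : Pt n p → ℝ}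

theorem contDiff_gradTheta (ha : ContDiff ℝ ∞ a) : ContDiff ℝ ∞ (gradTheta a) :=
  contDiff_euclidean.2 fun _ => contDiff_lineDeriv ha _

theorem contDiff_errOf (ha : ContDiff ℝ ∞ a) (i : Fin n) : ContDiff ℝ ∞ (errOf i a) :=
  ((contDiff_state i).sub ha).sub (contDiff_refValue i)

theorem contDiff_driftOf (ha : ContDiff ℝ ∞ a) (i : Fin n) : ContDiff ℝ ∞ (driftOf i a) :=
  ContDiff.sum fun _ _ => ((contDiff_lineDeriv ha _).mul (contDiff_state _)).add
    ((contDiff_lineDeriv ha _).mul (contDiff_refValue _))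

variable {φ : (i : Fin n) → EuclideanSpace ℝ (Fin (i + 1)) → EuclideanSpace ℝ (Fin p)}
  {c κ g : Fin n → ℝ}

theorem contDiff_regOf (hφ : ∀ i, ContDiff ℝ ∞ (φ i)) (ha : ContDiff ℝ ∞ a) (i : Fin n) :
    ContDiff ℝ ∞ (regOf φ i a) := by
  have hφ_trunc (j : Fin n) : ContDiff ℝ ∞ fun z : Pt n p => φ j (trunc z.1 j) :=
    (hφ j).comp (contDiff_euclidean.2 fun _ => contDiff_state _)
  exact (hφ_trunc i).sub <| ContDiff.sum fun j _ => (contDiff_lineDeriv ha _).smul (hφ_trunc j)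

theorem contDiff_dampOf (hφ : ∀ i, ContDiff ℝ ∞ (φ i)) (ha : ContDiff ℝ ∞ a) (i : Fin n) :
    ContDiff ℝ ∞ (dampOf φ c κ g i a) :=
  (contDiff_const.add (contDiff_const.mul ((contDiff_regOf hφ ha i).norm_sq ℝ))).add
    (contDiff_const.mul ((contDiff_gradTheta ha).norm_sq ℝ))

theorem virtualControl_succ (i : Fin n) (z : Pt n p) :
    virtualControl φ c κ g i.succ z =
      -(dampOf φ c κ g i (virtualControl φ c κ g i.castSucc) z *
          errOf i (virtualControl φ c κ g i.castSucc) z) -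
        inner ℝ (regOf φ i (virtualControl φ c κ g i.castSucc) z) z.2.1 +
        driftOf i (virtualControl φ c κ g i.castSucc) z := by
  simp only [virtualControl, Fin.induction_succ]

theorem contDiff_virtualControl (hφ : ∀ i, ContDiff ℝ ∞ (φ i)) (i : Fin (n + 1)) :
    ContDiff ℝ ∞ (virtualControl φ c κ g i) := by
  induction i using Fin.induction with
  | zero => exact contDiff_const
  | succ i ih =>
    rw [funext (virtualControl_succ (φ := φ) (c := c) (κ := κ) (g := g) i)]
    exact (((contDiff_dampOf hφ ih i).mul (contDiff_errOf ih i)).neg.sub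
      ((contDiff_regOf hφ ih i).inner ℝ (contDiff_fst.comp contDiff_snd))).add
      (contDiff_driftOf ih i)

theorem fderiv_pt_apply {z : Pt n p} (ha : DifferentiableAt ℝ a z) (v : Pt n p) :
    fderiv ℝ a z v = (∑ k, v.1 k * partialX a k z) + inner ℝ (gradTheta a z) v.2.1 +
      ∑ k, v.2.2 k * partialR a k z := by
  have hv : v = (∑ k, v.1 k • ((EuclideanSpace.single k 1, 0, 0) : Pt n p)) +
      (∑ j, v.2.1 j • ((0, EuclideanSpace.single j 1, 0) : Pt n p)) +
      ∑ k, v.2.2 k • ((0, 0, EuclideanSpace.single k 1) : Pt n p) := by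
    refine Prod.ext ?_ (Prod.ext ?_ ?_)
    all_goals
      ext k
      simp [Prod.fst_sum, Prod.snd_sum, Pi.single_apply]
  conv_lhs => rw [hv]
  simp only [map_add, map_sum, map_smul, smul_eq_mul, partialX, partialR, gradTheta,
    ha.lineDeriv_eq_fderiv, PiLp.inner_apply]
  simp

theorem fderiv_errOf_apply {z : Pt n p} (ha : DifferentiableAt ℝ a z) (i : Fin n) (v : Pt n p) :
    fderiv ℝ (errOf i a) z v = v.1 i - fderiv ℝ a z v - v.2.2 i := by
  have h_state := ((EuclideanSpace.proj i).comp
    (ContinuousLinearMap.fst ℝ (EuclideanSpace ℝ (Fin n)) _)).hasFDerivAt (x := z)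
  have h_ref := ((EuclideanSpace.proj i).comp ((ContinuousLinearMap.snd ℝ _ _).comp
    (ContinuousLinearMap.snd ℝ _ (_ × EuclideanSpace ℝ (Fin n))))).hasFDerivAt (x := z)
  exact congr_arg (· v) ((h_state.sub ha.hasFDerivAt).sub h_ref).fderiv

end Differentiation

section Dependence

/-- Two points with the same parameter estimate and the same state and reference coordinates of
index less than `m`. -/
def AgreeBelow (m : ℕ) (z z' : Pt n p) : Prop :=
  (∀ k : Fin n, (k : ℕ) < m → z.1 k = z'.1 k) ∧ z.2.1 = z'.2.1 ∧
    ∀ k : Fin n, (k : ℕ) < m → z.2.2 k = z'.2.2 k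

/-- The triangular structure of the design: `a` is a function of the parameter estimate and of the
state and reference coordinates of index less than `m`. -/
def DependsBelow {β : Type*} (m : ℕ) (a : Pt n p → β) : Prop :=
  ∀ z z', AgreeBelow m z z' → a z = a z'

variable {m : ℕ} {z z' : Pt n p}

theorem AgreeBelow.add (h : AgreeBelow m z z') (v : Pt n p) : AgreeBelow m (z + v) (z' + v) :=
  ⟨fun k hk => by simp [h.1 k hk], by simp [h.2.1], fun k hk => by simp [h.2.2 k hk]⟩

theorem AgreeBelow.mono {m' : ℕ} (h : AgreeBelow m z z') (hm : m' ≤ m) : AgreeBelow m' z z' :=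
  ⟨fun k hk => h.1 k (hk.trans_le hm), h.2.1, fun k hk => h.2.2 k (hk.trans_le hm)⟩

theorem AgreeBelow.trunc_eq (h : AgreeBelow m z z') {i : Fin n} (hi : (i : ℕ) < m) :
    trunc z.1 i = trunc z'.1 i := by
  ext k
  exact h.1 _ ((Nat.lt_succ_iff.1 k.isLt).trans_lt hi)

variable {a : Pt n p → ℝ}

protected theorem DependsBelow.lineDeriv (ha : DependsBelow m a) (v : Pt n p) :
    DependsBelow m fun z => lineDeriv ℝ a z v := by
  intro z z' h
  have h_line : (fun t : ℝ => a (z + t • v)) = fun t => a (z' + t • v) :=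
    funext fun t => ha _ _ (h.add _)
  exact congr_arg (deriv · 0) h_line

theorem DependsBelow.lineDeriv_eq_zero (ha : DependsBelow m a) (z : Pt n p) {v : Pt n p}
    (hv : AgreeBelow m v 0) : lineDeriv ℝ a z v = 0 := by
  have h_const : (fun t : ℝ => a (z + t • v)) = fun _ => a z := by
    refine funext fun t => ha _ _ ⟨fun k hk => ?_, ?_, fun k hk => ?_⟩
    · simpa using Or.inr (hv.1 k hk)
    · simpa using Or.inr hv.2.1
    · simpa using Or.inr (hv.2.2 k hk)
  rw [lineDeriv, h_const, deriv_const]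

theorem DependsBelow.partialX_eq_zero (ha : DependsBelow m a) {k : Fin n} (hk : m ≤ k)
    (z : Pt n p) : partialX a k z = 0 := by
  refine ha.lineDeriv_eq_zero _ ⟨fun l hl => ?_, rfl, fun _ _ => rfl⟩
  have hlk : l ≠ k := by rintro rfl; omega
  simp [hlk]

theorem DependsBelow.partialR_eq_zero (ha : DependsBelow m a) {k : Fin n} (hk : m ≤ k)
    (z : Pt n p) : partialR a k z = 0 := by
  refine ha.lineDeriv_eq_zero _ ⟨fun _ _ => rfl, rfl, fun l hl => ?_⟩
  have hlk : l ≠ k := by rintro rfl; omega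
  simp [hlk]

protected theorem DependsBelow.gradTheta (ha : DependsBelow m a) :
    DependsBelow m (gradTheta a) := by
  intro z z' h
  ext j
  exact ha.lineDeriv _ z z' h

protected theorem DependsBelow.errOf {i : Fin n} (ha : DependsBelow i a) :
    DependsBelow (i + 1) (errOf i a) := by
  intro z z' h
  unfold errOf
  rw [ha z z' (h.mono (by omega)), h.1 i (by omega), h.2.2 i (by omega)]

protected theorem DependsBelow.driftOf {i : Fin n} (ha : DependsBelow i a) :
    DependsBelow (i + 1) (driftOf i a) := by
  intro z z' h
  have h' : AgreeBelow i z z' := h.mono (by omega)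
  refine Finset.sum_congr rfl fun k _ => ?_
  rw [h.1 ⟨k + 1, by omega⟩ (by simp), h.2.2 ⟨k + 1, by omega⟩ (by simp)]
  exact congr_arg₂ _ (congr_arg (· * _) (ha.lineDeriv _ z z' h'))
    (congr_arg (· * _) (ha.lineDeriv _ z z' h'))

variable {φ : (i : Fin n) → EuclideanSpace ℝ (Fin (i + 1)) → EuclideanSpace ℝ (Fin p)}
  {c κ g : Fin n → ℝ}

protected theorem DependsBelow.regOf {i : Fin n} (ha : DependsBelow i a) :
    DependsBelow (i + 1) (regOf φ i a) := by
  intro z z' h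
  unfold regOf
  rw [h.trunc_eq (Nat.lt_succ_self i)]
  refine congr_arg _ (Finset.sum_congr rfl fun j hj => ?_)
  have hji : (j : ℕ) < i := (Finset.mem_filter.1 hj).2
  rw [h.trunc_eq (hji.trans (Nat.lt_succ_self i))]
  exact congr_arg (· • _) (ha.lineDeriv _ z z' (h.mono (by omega)))

protected theorem DependsBelow.dampOf {i : Fin n} (ha : DependsBelow i a) :
    DependsBelow (i + 1) (dampOf φ c κ g i a) := by
  intro z z' h
  unfold dampOf
  rw [ha.regOf z z' h, ha.gradTheta z z' (h.mono (by omega))]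

theorem dependsBelow_virtualControl (i : Fin (n + 1)) :
    DependsBelow i (virtualControl φ c κ g i) := by
  induction i using Fin.induction with
  | zero => exact fun _ _ _ => rfl
  | succ i ih =>
    intro z z' h
    rw [Fin.val_castSucc] at ih
    rw [virtualControl_succ, virtualControl_succ, ih.dampOf z z' h, ih.errOf z z' h,
      ih.regOf z z' h, h.2.1, ih.driftOf z z' h]

end Dependence

section ErrorDynamics

/-- The sequence of coordinates of `v`, continued by `d` beyond the last one. It encodes the
conventions `x_{n+1} = u`, `r^(n)` after `r^(n-1)`, and `h_{n+1} = 0`. -/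
def coordExtend (v : EuclideanSpace ℝ (Fin n)) (d : ℝ) (k : ℕ) : ℝ :=
  if hk : k < n then v ⟨k, hk⟩ else d

theorem coordExtend_of_lt {v : EuclideanSpace ℝ (Fin n)} {d : ℝ} {k : ℕ} (hk : k < n) :
    coordExtend v d k = v ⟨k, hk⟩ :=
  dif_pos hk

theorem coordExtend_of_le {v : EuclideanSpace ℝ (Fin n)} {d : ℝ} {k : ℕ} (hk : n ≤ k) :
    coordExtend v d k = d :=
  dif_neg hk.not_gt

theorem sum_eq_sum_fin_of_le {M : Type*} [AddCommMonoid M] (i : Fin n) {F : Fin n → M}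
    (hF : ∀ k, i ≤ k → F k = 0) : ∑ k, F k = ∑ k : Fin i, F ⟨k, by omega⟩ := by
  refine Eq.trans ?_ (Finset.sum_map Finset.univ (Fin.castLEEmb i.isLt.le) F)
  refine (Finset.sum_subset (Finset.subset_univ _) fun k _ hk => hF k ?_).symm
  by_contra! hlt
  exact hk (Finset.mem_map.2 ⟨⟨k, hlt⟩, Finset.mem_univ _, rfl⟩)

variable {φ : (i : Fin n) → EuclideanSpace ℝ (Fin (i + 1)) → EuclideanSpace ℝ (Fin p)}
  {c κ g : Fin n → ℝ} {a : Pt n p → ℝ}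

theorem DependsBelow.driftOf_eq_sum {i : Fin n} (ha : DependsBelow i a) (z : Pt n p) (u ρ : ℝ) :
    driftOf i a z = ∑ k : Fin n, (partialX a k z * coordExtend z.1 u (k + 1) +
      partialR a k z * coordExtend z.2.2 ρ (k + 1)) := by
  rw [sum_eq_sum_fin_of_le i fun k hk => by
    rw [ha.partialX_eq_zero hk, ha.partialR_eq_zero hk, zero_mul, zero_mul, add_zero]]
  refine Finset.sum_congr rfl fun k _ => ?_
  have hk : (k : ℕ) + 1 < n := by omega
  rw [coordExtend_of_lt hk, coordExtend_of_lt hk]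

theorem DependsBelow.regOf_eq_sub_sum {i : Fin n} (ha : DependsBelow i a) (z : Pt n p) :
    regOf φ i a z =
      φ i (trunc z.1 i) - ∑ k, partialX a k z • φ k (trunc z.1 k) := by
  refine congr_arg _ (Finset.sum_subset (Finset.filter_subset _ _) fun k _ hk => ?_)
  have hik : i ≤ k := by simpa using hk
  rw [ha.partialX_eq_zero hik, zero_smul]

/-- The velocity of the point `(x, θ̂, r, …, r^(n-1))` along the plant with input `u` and parameter
`θ`, when `r^(n)` and `θ̂'` have the values `ρ` and `η`. -/
def plantVelocity (φ : (i : Fin n) → EuclideanSpace ℝ (Fin (i + 1)) → EuclideanSpace ℝ (Fin p))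
    (θ : EuclideanSpace ℝ (Fin p)) (z : Pt n p) (u ρ : ℝ) (η : EuclideanSpace ℝ (Fin p)) :
    Pt n p :=
  (WithLp.toLp 2 fun k : Fin n => coordExtend z.1 u (k + 1) + inner ℝ (φ k (trunc z.1 k)) θ, η,
    WithLp.toLp 2 fun k : Fin n => coordExtend z.2.2 ρ (k + 1))

theorem DependsBelow.fderiv_plantVelocity {i : Fin n} (ha : DependsBelow i a)
    {z : Pt n p} (hd : DifferentiableAt ℝ a z) (θ η : EuclideanSpace ℝ (Fin p)) (u ρ : ℝ) :
    fderiv ℝ a z (plantVelocity φ θ z u ρ η) = driftOf i a z +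
      inner ℝ (φ i (trunc z.1 i) - regOf φ i a z) θ +
      inner ℝ (gradTheta a z) η := by
  rw [fderiv_pt_apply hd, ha.driftOf_eq_sum z u ρ, ha.regOf_eq_sub_sum, sub_sub_cancel, sum_inner]
  simp only [plantVelocity, real_inner_smul_left, add_mul, Finset.sum_add_distrib,
    mul_comm (partialX _ _ _), mul_comm (partialR _ _ _)]
  ring

variable (φ) (c κ g) (i : Fin n)

/-- The regressor `w_i` of the adaptive backstepping design. -/
def regressor (z : Pt n p) : EuclideanSpace ℝ (Fin p) :=
  regOf φ i (virtualControl φ c κ g i.castSucc) z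

/-- The sensitivity `∂α_{i-1}/∂θ̂` of the `i`-th virtual control to the parameter estimate. -/
def sensitivity (z : Pt n p) : EuclideanSpace ℝ (Fin p) :=
  gradTheta (virtualControl φ c κ g i.castSucc) z

/-- The damping coefficient `s_i = c_i + κ_i |w_i|² + g_i |∂α_{i-1}/∂θ̂|²`. -/
def damping (z : Pt n p) : ℝ :=
  dampOf φ c κ g i (virtualControl φ c κ g i.castSucc) z

/-- The disturbance `w_iᵀ θ̃ - (∂α_{i-1}/∂θ̂) θ̂'` of the `i`-th error equation, where `η` is the
value of `θ̂'`. -/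
def perturbation (θ : EuclideanSpace ℝ (Fin p)) (z : Pt n p) (η : EuclideanSpace ℝ (Fin p)) : ℝ :=
  inner ℝ (regressor φ c κ g i z) (θ - z.2.1) - inner ℝ (sensitivity φ c κ g i z) η

variable {φ c κ g} {i}

theorem coordExtend_overrideControl (z : Pt n p) (ρ : ℝ) :
    coordExtend z.1 (overrideControl φ c κ g z ρ) (i + 1) =
      coordExtend (err φ c κ g z) 0 (i + 1) + virtualControl φ c κ g i.succ z +
        coordExtend z.2.2 ρ (i + 1) := by
  rcases Nat.lt_or_ge (i + 1) n with hi | hi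
  · have h_succ : (⟨i + 1, hi⟩ : Fin n).castSucc = i.succ := rfl
    simp only [coordExtend_of_lt hi, err, errOf, h_succ]
    ring
  · have h_last : i.succ = Fin.last n := Fin.ext (by simp; omega)
    simp only [coordExtend_of_le hi, overrideControl, h_last, zero_add]

theorem fderiv_err_plantVelocity (hφ : ∀ i, ContDiff ℝ ∞ (φ i)) (θ η : EuclideanSpace ℝ (Fin p))
    (z : Pt n p) (ρ : ℝ) :
    fderiv ℝ (fun z => err φ c κ g z i) z
        (plantVelocity φ θ z (overrideControl φ c κ g z ρ) ρ η) =
      coordExtend (err φ c κ g z) 0 (i + 1) - damping φ c κ g i z * err φ c κ g z i +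
        perturbation φ c κ g i θ z η := by
  have hα : DifferentiableAt ℝ (virtualControl φ c κ g i.castSucc) z :=
    (contDiff_virtualControl hφ _).differentiable (by simp) z
  have h_input := coordExtend_overrideControl (φ := φ) (c := c) (κ := κ) (g := g) (i := i) z ρ
  have h_chain := (dependsBelow_virtualControl i.castSucc).fderiv_plantVelocity hα (φ := φ) (i := i)
    θ η (overrideControl φ c κ g z ρ) ρ
  rw [virtualControl_succ] at h_input
  refine (fderiv_errOf_apply hα i _).trans ?_
  rw [h_chain]
  simp only [plantVelocity, h_input, perturbation, regressor, sensitivity, damping, err,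
    inner_sub_left, inner_sub_right]
  ring

end ErrorDynamics

section Reference

theorem norm_sub_le_of_norm_deriv_le_off_countable {E : Type*} [NormedAddCommGroup E]
    [NormedSpace ℝ E] [CompleteSpace E] {f : ℝ → E} {a b C : ℝ} {S : Set ℝ} (hab : a ≤ b)
    (hS : S.Countable) (hf : ContinuousOn f (Icc a b))
    (hd : ∀ t ∈ Ioo a b \ S, DifferentiableAt ℝ f t)
    (hC : ∀ t ∈ Ioo a b \ S, ‖deriv f t‖ ≤ C) : ‖f b - f a‖ ≤ C * (b - a) := by
  have h_bound : ∀ᵐ t, t ∈ Ioc a b → ‖deriv f t‖ ≤ C := by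
    filter_upwards [hS.ae_notMem volume, (countable_singleton b).ae_notMem volume] with t htS htb ht
    exact hC t ⟨⟨ht.1, lt_of_le_of_ne ht.2 htb⟩, htS⟩
  have h_int : IntervalIntegrable (deriv f) volume a b := by
    rw [intervalIntegrable_iff_integrableOn_Ioc_of_le hab]
    exact Measure.integrableOn_of_bounded (M := C) (by simp)
      (stronglyMeasurable_deriv f).aestronglyMeasurable
      ((ae_restrict_iff' measurableSet_Ioc).2 h_bound)
  rw [← integral_eq_of_hasDerivAt_off_countable_of_le f (deriv f) hab hS hf
    (fun t ht => (hd t ht).hasDerivAt) h_int, ← abs_of_nonneg (sub_nonneg.2 hab)]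
  exact intervalIntegral.norm_integral_le_of_norm_le_const_ae (by rwa [uIoc_of_le hab])

variable {r : ℝ → ℝ}

theorem hasDerivAt_refDeriv {k : ℕ} {t : ℝ} (ht : 0 < t)
    (hd : DifferentiableWithinAt ℝ (refDeriv r k) (Ici 0) t) :
    HasDerivAt (refDeriv r k) (refDeriv r (k + 1) t) t := by
  have h_succ : refDeriv r (k + 1) t = derivWithin (refDeriv r k) (Ici 0) t := by
    rw [refDeriv, iteratedDerivWithin_succ]
    rfl
  exact h_succ ▸ hd.hasDerivWithinAt.hasDerivAt (Ici_mem_nhds ht)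

theorem IsReference.continuousOn_refDeriv (hr : IsReference n r) {k : ℕ} (hk : k < n) :
    ContinuousOn (refDeriv r k) (Ici 0) :=
  hr.contDiffOn.continuousOn_iteratedDerivWithin (by exact_mod_cast Nat.le_sub_one_of_lt hk)
    (uniqueDiffOn_Ici 0)

theorem IsReference.exists_countable_hasDerivAt (hr : IsReference n r) :
    ∃ S : Set ℝ, S.Countable ∧
      ∀ t, 0 < t → t ∉ S → ∀ k < n, HasDerivAt (refDeriv r k) (refDeriv r (k + 1) t) t := by
  obtain ⟨S, hS, hd⟩ := hr.piecewise
  refine ⟨⋃ N : ℕ, S ∩ Icc 0 N, countable_iUnion fun N => (hS.1 N).countable, ?_⟩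
  intro t ht htS k hk
  have ht_notMem : t ∉ S := by
    obtain ⟨N, hN⟩ := exists_nat_ge t
    exact fun h => htS (mem_iUnion.2 ⟨N, h, ht.le, hN⟩)
  refine hasDerivAt_refDeriv ht ?_
  rcases (Nat.le_sub_one_of_lt hk).eq_or_lt with rfl | h_lt
  · exact hd t ⟨ht.le, ht_notMem⟩
  · exact hr.contDiffOn.differentiableOn_iteratedDerivWithin (by exact_mod_cast h_lt)
      (uniqueDiffOn_Ici 0) t ht.le

theorem IsReference.ae_hasDerivAt (hr : IsReference n r) :
    ∀ᵐ t, 0 ≤ t → ∀ k < n, HasDerivAt (refDeriv r k) (refDeriv r (k + 1) t) t := by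
  obtain ⟨S, hS, hd⟩ := hr.exists_countable_hasDerivAt
  filter_upwards [hS.ae_notMem volume, (countable_singleton (0 : ℝ)).ae_notMem volume]
    with t htS ht0 ht
  exact hd t (lt_of_le_of_ne ht (Ne.symm ht0)) htS

theorem IsReference.exists_lipschitzOnWith (hr : IsReference n r) :
    ∃ K : NNReal, ∀ k < n, LipschitzOnWith K (refDeriv r k) (Ici 0) := by
  obtain ⟨S, hS, hd⟩ := hr.exists_countable_hasDerivAt
  obtain ⟨M, hM⟩ := hr.bounded
  refine ⟨M.toNNReal, fun k hk => LipschitzOnWith.of_dist_le_mul fun s hs t ht => ?_⟩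
  wlog hst : s ≤ t generalizing s t
  · rw [dist_comm, dist_comm s]
    exact this t ht s hs (le_of_not_ge hst)
  have h_deriv : ∀ u ∈ Ioo s t \ S, HasDerivAt (refDeriv r k) (refDeriv r (k + 1) u) u :=
    fun u hu => hd u (lt_of_le_of_lt hs hu.1.1) hu.2 k hk
  rw [dist_comm, dist_comm s, dist_eq_norm, Real.dist_eq, abs_of_nonneg (sub_nonneg.2 hst)]
  refine (norm_sub_le_of_norm_deriv_le_off_countable hst hS
    ((hr.continuousOn_refDeriv hk).mono (Icc_subset_Ici_self.trans (Ici_subset_Ici.2 hs)))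
    (fun u hu => (h_deriv u hu).differentiableAt) fun u hu => ?_).trans
    (mul_le_mul_of_nonneg_right (Real.le_coe_toNNReal M) (sub_nonneg.2 hst))
  rw [(h_deriv u hu).deriv]
  exact hM (k + 1) hk u (hs.trans hu.1.1.le)

theorem IsReference.absolutelyContinuousOnInterval (hr : IsReference n r) {T : ℝ} (hT : 0 ≤ T) :
    AbsolutelyContinuousOnInterval
      (fun t => (WithLp.toLp 2 fun k : Fin n => refDeriv r k t : EuclideanSpace ℝ (Fin n)))
      0 T := by
  obtain ⟨K, hK⟩ := hr.exists_lipschitzOnWith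
  have h_pi : LipschitzOnWith K (fun t => fun k : Fin n => refDeriv r k t) (uIcc 0 T) := by
    refine LipschitzOnWith.of_dist_le_mul fun s hs t ht => ?_
    rw [uIcc_of_le hT] at hs ht
    exact (dist_pi_le_iff (by positivity)).2 fun k => (hK k k.isLt).dist_le_mul s hs.1 t ht.1
  exact ((PiLp.lipschitzWith_toLp 2 fun _ : Fin n => ℝ).comp_lipschitzOnWith
    h_pi).absolutelyContinuousOnInterval

end Reference

section Trajectory

variable {φ : (i : Fin n) → EuclideanSpace ℝ (Fin (i + 1)) → EuclideanSpace ℝ (Fin p)}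
  {c κ g : Fin n → ℝ} {r : ℝ → ℝ} {θ : EuclideanSpace ℝ (Fin p)} {tf : EReal}
  {x : ℝ → EuclideanSpace ℝ (Fin n)} {θhat : ℝ → EuclideanSpace ℝ (Fin p)} {T : ℝ}

theorem Icc_subset_timeInterval (hT : T ∈ timeInterval tf) : Icc 0 T ⊆ timeInterval tf :=
  fun _ ht => ⟨ht.1, (EReal.coe_le_coe_iff.2 ht.2).trans_lt hT.2⟩

theorem IsClosedLoop.absolutelyContinuousOnInterval_ptAt (hr : IsReference n r)
    (hsol : IsClosedLoop φ c κ g r θ tf x θhat) (hT : T ∈ timeInterval tf) :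
    AbsolutelyContinuousOnInterval (ptAt r x θhat) 0 T :=
  absolutelyContinuousOnInterval_prodMk (hsol.x_ac T hT)
    (absolutelyContinuousOnInterval_prodMk (hsol.θhat_ac T hT)
      (hr.absolutelyContinuousOnInterval hT.1))

theorem IsClosedLoop.absolutelyContinuousOnInterval_err (hφ : ∀ i, ContDiff ℝ ∞ (φ i))
    (hr : IsReference n r) (hsol : IsClosedLoop φ c κ g r θ tf x θhat)
    (hT : T ∈ timeInterval tf) (i : Fin n) :
    AbsolutelyContinuousOnInterval (fun t => err φ c κ g (ptAt r x θhat t) i) 0 T := by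
  have h_smooth : ContDiff ℝ ∞ (errOf i (virtualControl φ c κ g i.castSucc)) :=
    contDiff_errOf (contDiff_virtualControl hφ _) i
  have h_ac := absolutelyContinuousOnInterval_comp_contDiffAt
    (hsol.absolutelyContinuousOnInterval_ptAt hr hT) fun _ _ =>
      (h_smooth.of_le (by simp)).contDiffAt
  simpa only [err] using h_ac

theorem coordExtend_refDeriv {k : ℕ} (hk : k ≤ n) (t : ℝ) :
    coordExtend (WithLp.toLp 2 fun k : Fin n => refDeriv r k t) (refDeriv r n t) k =
      refDeriv r k t := by
  rcases hk.lt_or_eq with hk | rfl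
  · rw [coordExtend_of_lt hk]
  · rw [coordExtend_of_le le_rfl]

theorem IsClosedLoop.ae_hasDerivAt_ptAt (hr : IsReference n r)
    (hsol : IsClosedLoop φ c κ g r θ tf x θhat) (hT : T ∈ timeInterval tf) :
    ∀ᵐ t, t ∈ Icc 0 T → HasDerivAt (ptAt r x θhat)
      (plantVelocity φ θ (ptAt r x θhat t)
        (overrideControl φ c κ g (ptAt r x θhat t) (refDeriv r n t)) (refDeriv r n t)
        (deriv θhat t)) t := by
  have h_plant := ae_restrict_of_ae_restrict_of_subset (Icc_subset_timeInterval hT) hsol.dynamics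
  rw [ae_restrict_iff' measurableSet_Icc] at h_plant
  have h_estimate := ae_hasDerivAt_of_absolutelyContinuousOnInterval (hsol.θhat_ac T hT)
  rw [uIcc_of_le hT.1] at h_estimate
  filter_upwards [h_plant, h_estimate, hr.ae_hasDerivAt] with t hx hθhat href ht
  refine (hasDerivAt_of_coord (hx ht)).prodMk ((hθhat ht).prodMk (hasDerivAt_of_coord fun k => ?_))
  exact (href ht.1 k k.isLt).congr_deriv (coordExtend_refDeriv k.isLt t).symm

theorem IsClosedLoop.ae_hasDerivAt_err (hφ : ∀ i, ContDiff ℝ ∞ (φ i)) (hr : IsReference n r)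
    (hsol : IsClosedLoop φ c κ g r θ tf x θhat) (hT : T ∈ timeInterval tf) :
    ∀ᵐ t, t ∈ Icc 0 T → ∀ i : Fin n,
      HasDerivAt (fun u => err φ c κ g (ptAt r x θhat u) i)
        (coordExtend (err φ c κ g (ptAt r x θhat t)) 0 (i + 1) -
          damping φ c κ g i (ptAt r x θhat t) * err φ c κ g (ptAt r x θhat t) i +
          perturbation φ c κ g i θ (ptAt r x θhat t) (deriv θhat t)) t := by
  filter_upwards [hsol.ae_hasDerivAt_ptAt hr hT] with t ht_pt ht i
  have h_err : DifferentiableAt ℝ (fun z => err φ c κ g z i) (ptAt r x θhat t) :=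
    (contDiff_errOf (contDiff_virtualControl hφ i.castSucc) i).differentiable (by simp) _
  rw [← fderiv_err_plantVelocity hφ θ (deriv θhat t) (ptAt r x θhat t) (refDeriv r n t)]
  exact h_err.hasFDerivAt.comp_hasDerivAt t (ht_pt ht)

end Trajectory

section Norms

theorem exists_norm_bound_of_coord {α ι : Type*} [Fintype ι] {I : Set α}
    {v : α → EuclideanSpace ℝ ι} (h : ∀ i, ∃ M : ℝ, ∀ t ∈ I, |v t i| ≤ M) :
    ∃ M : ℝ, ∀ t ∈ I, ‖v t‖ ≤ M := by
  choose M hM using h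
  refine ⟨√(∑ i, M i ^ 2), fun t ht => ?_⟩
  rw [EuclideanSpace.norm_eq]
  exact Real.sqrt_le_sqrt <| Finset.sum_le_sum fun i _ =>
    pow_le_pow_left₀ (norm_nonneg _) (hM i t ht) 2

theorem ciInf_pos_of_finite {ι : Type*} [Finite ι] [Nonempty ι] {f : ι → ℝ} (hf : ∀ i, 0 < f i) :
    0 < ⨅ i, f i := by
  obtain ⟨i, hi⟩ := exists_eq_ciInf_of_finite (f := f)
  exact hi ▸ hf i

theorem ciInf_le_of_finite {ι : Type*} [Finite ι] (f : ι → ℝ) (i : ι) : ⨅ i, f i ≤ f i :=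
  ciInf_le (Set.finite_range f).bddBelow i

theorem minTail_le {g : Fin n → ℝ} {i : Fin n} (hi : 0 < (i : ℕ)) : minTail g ≤ g i :=
  ciInf_le_of_finite (fun i : {i : Fin n // 0 < (i : ℕ)} => g i) ⟨i, hi⟩

theorem minTail_pos {g : Fin n → ℝ} (hn : 1 < n) (hg : ∀ i, 0 < g i) : 0 < minTail g := by
  have : Nonempty {i : Fin n // 0 < (i : ℕ)} := ⟨⟨⟨1, hn⟩, by simp⟩⟩
  exact ciInf_pos_of_finite fun i => hg i

variable {tf : EReal} {v : ℝ → EuclideanSpace ℝ (Fin p)} {T : ℝ}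

theorem sigNorm_nonneg (q : ℝ≥0∞) : 0 ≤ sigNorm q tf v :=
  ENNReal.toReal_nonneg

theorem ae_norm_le_sigNorm (hv : MemLp v ⊤ (volume.restrict (timeInterval tf)))
    (hT : T ∈ timeInterval tf) : ∀ᵐ t, t ∈ Icc 0 T → ‖v t‖ ≤ sigNorm ⊤ tf v := by
  rw [← ae_restrict_iff' measurableSet_Icc]
  refine ae_restrict_of_ae_restrict_of_subset (Icc_subset_timeInterval hT) ?_
  filter_upwards [ae_le_eLpNormEssSup (f := v) (μ := volume.restrict (timeInterval tf))] with t ht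
  rw [← eLpNorm_exponent_top] at ht
  simpa only [sigNorm, toReal_enorm] using ENNReal.toReal_mono hv.eLpNorm_ne_top ht

theorem exists_mem_timeInterval_gt {t : ℝ} (ht : t ∈ timeInterval tf) :
    ∃ T ∈ timeInterval tf, t < T := by
  obtain ⟨T, htT, hT⟩ := EReal.lt_iff_exists_real_btwn.1 ht.2
  have htT : t < T := EReal.coe_lt_coe_iff.1 htT
  exact ⟨T, ⟨ht.1.trans htT.le, hT⟩, htT⟩

theorem norm_le_sigNorm (hv : MemLp v ⊤ (volume.restrict (timeInterval tf)))
    (hv_cont : ∀ T ∈ timeInterval tf, ContinuousOn v (Icc 0 T)) {t : ℝ}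
    (ht : t ∈ timeInterval tf) : ‖v t‖ ≤ sigNorm ⊤ tf v := by
  obtain ⟨T, hT, htT⟩ := exists_mem_timeInterval_gt ht
  have h_ae : (fun u => max ‖v u‖ (sigNorm ⊤ tf v)) =ᵐ[volume.restrict (Icc 0 T)]
      fun _ => sigNorm ⊤ tf v := by
    rw [EventuallyEq, ae_restrict_iff' measurableSet_Icc]
    filter_upwards [ae_norm_le_sigNorm hv hT] with u hu hm
    exact max_eq_right (hu hm)
  exact max_eq_right_iff.1 <| Measure.eqOn_Icc_of_ae_eq volume (ht.1.trans_lt htT).ne h_ae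
    ((hv_cont T hT).norm.sup continuousOn_const) continuousOn_const ⟨ht.1, htT.le⟩

theorem intervalIntegrable_norm_sq (hv : MemLp v 2 (volume.restrict (timeInterval tf)))
    (hT : T ∈ timeInterval tf) : IntervalIntegrable (fun t => ‖v t‖ ^ 2) volume 0 T := by
  rw [intervalIntegrable_iff_integrableOn_Icc_of_le hT.1]
  exact IntegrableOn.mono_set hv.norm.integrable_sq (Icc_subset_timeInterval hT)

theorem integral_norm_sq_le_sigNorm_sq (hv : MemLp v 2 (volume.restrict (timeInterval tf)))
    (hT : T ∈ timeInterval tf) : ∫ t in (0 : ℝ)..T, ‖v t‖ ^ 2 ≤ sigNorm 2 tf v ^ 2 := by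
  have h_norm : sigNorm 2 tf v ^ 2 = ∫ t in timeInterval tf, ‖v t‖ ^ 2 := by
    rw [sigNorm, hv.eLpNorm_eq_integral_rpow_norm (by simp) (by simp),
      ENNReal.toReal_ofReal (by positivity), ← Real.rpow_natCast, ← Real.rpow_mul (by positivity)]
    simp
  rw [h_norm, intervalIntegral.integral_of_le hT.1]
  exact setIntegral_mono_set hv.norm.integrable_sq (Eventually.of_forall fun t => sq_nonneg _)
    (Ioc_subset_Icc_self.trans (Icc_subset_timeInterval hT)).eventuallyLE

end Norms

section Gains

variable {φ : (i : Fin n) → EuclideanSpace ℝ (Fin (i + 1)) → EuclideanSpace ℝ (Fin p)}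
  {c κ g : Fin n → ℝ} {i : Fin n} {z : Pt n p} {b : ℝ}

theorem le_damping (hκ : 0 ≤ κ i) (hg : 0 ≤ g i) : c i ≤ damping φ c κ g i z := by
  have h_damp : 0 ≤ κ i * ‖regressor φ c κ g i z‖ ^ 2 + g i * ‖sensitivity φ c κ g i z‖ ^ 2 := by
    positivity
  unfold damping dampOf
  exact (le_add_of_nonneg_right h_damp).trans_eq (add_assoc _ _ _).symm

theorem add_regressor_le_damping (hg : 0 ≤ g i) :
    c i + κ i * ‖regressor φ c κ g i z‖ ^ 2 ≤ damping φ c κ g i z :=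
  le_add_of_nonneg_right (by positivity)

theorem add_sensitivity_le_damping (hκ : 0 ≤ κ i) :
    c i + g i * ‖sensitivity φ c κ g i z‖ ^ 2 ≤ damping φ c κ g i z :=
  add_le_add_left (le_add_of_nonneg_right (by positivity)) _

theorem sensitivity_eq_zero (hi : (i : ℕ) = 0) : sensitivity φ c κ g i z = 0 := by
  have h_first : i.castSucc = 0 := Fin.ext (by simpa using hi)
  rw [sensitivity, h_first]
  ext j
  simp [gradTheta, lineDeriv, virtualControl]

theorem minTail_mul_sensitivity_sq_le :
    minTail g * ‖sensitivity φ c κ g i z‖ ^ 2 ≤ g i * ‖sensitivity φ c κ g i z‖ ^ 2 := by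
  rcases Nat.eq_zero_or_pos i with hi | hi
  · simp [sensitivity_eq_zero hi]
  · exact mul_le_mul_of_nonneg_right (minTail_le hi) (sq_nonneg _)

theorem mul_le_div_sqrt_mul {c κ s y a : ℝ} (hc : 0 < c) (hκ : 0 < κ) (ha : 0 ≤ a)
    (h : c + κ * y ^ 2 ≤ s) : y * a ≤ a / (2 * √(c * κ)) * s := by
  have h_amgm : 2 * √(c * κ) * y ≤ s := by
    rw [Real.sqrt_mul hc.le]
    nlinarith [sq_nonneg (√c - √κ * y), Real.sq_sqrt hc.le, Real.sq_sqrt hκ.le]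
  rw [div_mul_eq_mul_div, le_div_iff₀ (by positivity)]
  linarith [mul_le_mul_of_nonneg_left h_amgm ha]

theorem norm_regressor_mul_le (hc : ∀ i, 0 < c i) (hκ : ∀ i, 0 < κ i) (hg : 0 ≤ g i)
    (hb : 0 ≤ b) : ‖regressor φ c κ g i z‖ * b ≤
      b / (2 * √((⨅ i, c i) * ⨅ i, κ i)) * damping φ c κ g i z := by
  have : Nonempty (Fin n) := ⟨i⟩
  refine mul_le_div_sqrt_mul (ciInf_pos_of_finite hc) (ciInf_pos_of_finite hκ) hb ?_
  exact (add_le_add (ciInf_le_of_finite c i)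
    (mul_le_mul_of_nonneg_right (ciInf_le_of_finite κ i) (sq_nonneg _))).trans
    (add_regressor_le_damping hg)

theorem norm_sensitivity_mul_le (hn : 1 < n) (hc : ∀ i, 0 < c i) (hκ : 0 ≤ κ i)
    (hg : ∀ i, 0 < g i) (hb : 0 ≤ b) : ‖sensitivity φ c κ g i z‖ * b ≤
      b / (2 * √((⨅ i, c i) * minTail g)) * damping φ c κ g i z := by
  have : Nonempty (Fin n) := ⟨i⟩
  refine mul_le_div_sqrt_mul (ciInf_pos_of_finite hc) (minTail_pos hn hg) hb ?_
  exact (add_le_add (ciInf_le_of_finite c i) minTail_mul_sensitivity_sq_le).trans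
    (add_sensitivity_le_damping hκ)

theorem abs_perturbation_le (θ η : EuclideanSpace ℝ (Fin p)) :
    |perturbation φ c κ g i θ z η| ≤
      ‖regressor φ c κ g i z‖ * ‖θ - z.2.1‖ + ‖sensitivity φ c κ g i z‖ * ‖η‖ :=
  (abs_sub _ _).trans (add_le_add (abs_real_inner_le_norm _ _) (abs_real_inner_le_norm _ _))

theorem err_succ_eq (hi : (i : ℕ) + 1 < n) :
    err φ c κ g z ⟨i + 1, hi⟩ =
      gainBracket φ c κ g z i hi + damping φ c κ g i z * err φ c κ g z i := by
  have h_succ : (⟨i + 1, hi⟩ : Fin n).castSucc = i.succ := rfl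
  simp only [err, errOf, gainBracket, damping, h_succ, virtualControl_succ]
  ring

theorem neg_gainBracket_le {hi : (i : ℕ) + 1 < n} (hgain : gainLower φ c κ g z i hi ≤ (c i : EReal))
    (h_err : 0 ≤ err φ c κ g z i) :
    -gainBracket φ c κ g z i hi ≤ c i * err φ c κ g z i := by
  unfold gainLower at hgain
  split_ifs at hgain with h_zero h_bracket
  · simp at hgain
  · rw [h_zero, mul_zero]
    exact neg_nonpos.2 (not_lt.1 h_bracket)
  · have h_pos : 0 < err φ c κ g z i := lt_of_le_of_ne h_err (Ne.symm h_zero)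
    rwa [EReal.coe_le_coe_iff, neg_mul, inv_mul_eq_div, ← neg_div, div_le_iff₀ h_pos] at hgain

theorem err_nonneg (hκ : ∀ i, 0 ≤ κ i) (hg : ∀ i, 0 ≤ g i)
    (hgain : ∀ (i : Fin n) (hi : (i : ℕ) + 1 < n), gainLower φ c κ g z i hi ≤ (c i : EReal))
    (h0 : ∀ hn : 0 < n, z.2.2 ⟨0, hn⟩ ≤ z.1 ⟨0, hn⟩) (i : Fin n) : 0 ≤ err φ c κ g z i := by
  obtain ⟨k, hk⟩ := i
  induction k with
  | zero =>
    have h_first : (⟨0, hk⟩ : Fin n).castSucc = 0 := rfl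
    simpa [err, errOf, h_first, virtualControl] using h0 hk
  | succ k ih =>
    have h_err := ih (by omega)
    have h_bracket := neg_gainBracket_le (hgain ⟨k, by omega⟩ hk) h_err
    have h_damp := mul_le_mul_of_nonneg_right
      (le_damping (φ := φ) (c := c) (z := z) (hκ ⟨k, by omega⟩) (hg _)) h_err
    rw [err_succ_eq (i := ⟨k, by omega⟩) hk]
    linarith

end Gains

section Boundedness

variable {α : Type*} {I : Set α} {z : α → Pt n p}

theorem DependsBelow.exists_bound {m : ℕ} {a : Pt n p → ℝ} (ha : DependsBelow m a)
    (ha_cont : Continuous a)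
    (hx : ∀ k : Fin n, (k : ℕ) < m → ∃ M : ℝ, ∀ t ∈ I, |(z t).1 k| ≤ M)
    (hθ : ∃ M : ℝ, ∀ t ∈ I, ‖(z t).2.1‖ ≤ M) (hρ : ∃ M : ℝ, ∀ t ∈ I, ‖(z t).2.2‖ ≤ M) :
    ∃ M : ℝ, ∀ t ∈ I, |a (z t)| ≤ M := by
  set cut : α → EuclideanSpace ℝ (Fin n) := fun t =>
    WithLp.toLp 2 fun k : Fin n => if (k : ℕ) < m then (z t).1 k else 0
  have h_cut : ∃ M : ℝ, ∀ t ∈ I, ‖cut t‖ ≤ M := by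
    refine exists_norm_bound_of_coord fun k => ?_
    by_cases hk : (k : ℕ) < m
    · simpa only [cut, hk, if_true] using hx k hk
    · exact ⟨0, fun t _ => by simp [cut, hk]⟩
  obtain ⟨M₁, h₁⟩ := h_cut
  obtain ⟨M₂, h₂⟩ := hθ
  obtain ⟨M₃, h₃⟩ := hρ
  obtain ⟨C, hC⟩ := (isCompact_closedBall (0 : Pt n p)
    (max M₁ (max M₂ M₃))).exists_bound_of_continuousOn ha_cont.continuousOn
  refine ⟨C, fun t ht => ?_⟩
  rw [ha (z t) (cut t, (z t).2)
    ⟨fun k hk => by simp only [cut, hk, if_true], rfl, fun _ _ => rfl⟩]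
  refine hC _ (mem_closedBall_zero_iff.2 ?_)
  exact max_le_max (h₁ t ht) (max_le_max (h₂ t ht) (h₃ t ht))

variable {φ : (i : Fin n) → EuclideanSpace ℝ (Fin (i + 1)) → EuclideanSpace ℝ (Fin p)}
  {c κ g : Fin n → ℝ}

theorem exists_bound_state (hφ : ∀ i, ContDiff ℝ ∞ (φ i))
    (hθ : ∃ M : ℝ, ∀ t ∈ I, ‖(z t).2.1‖ ≤ M) (hρ : ∃ M : ℝ, ∀ t ∈ I, ‖(z t).2.2‖ ≤ M)
    (hh : ∀ i, ∃ M : ℝ, ∀ t ∈ I, |err φ c κ g (z t) i| ≤ M) (i : Fin n) :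
    ∃ M : ℝ, ∀ t ∈ I, |(z t).1 i| ≤ M := by
  induction i using WellFoundedLT.induction with
  | ind i ih =>
    obtain ⟨C, hC⟩ := (dependsBelow_virtualControl (φ := φ) (c := c) (κ := κ) (g := g)
      i.castSucc).exists_bound (contDiff_virtualControl hφ _).continuous ih hθ hρ
    obtain ⟨Mρ, hMρ⟩ := hρ
    obtain ⟨Mh, hMh⟩ := hh i
    refine ⟨Mh + C + Mρ, fun t ht => ?_⟩
    have hx : (z t).1 i = err φ c κ g (z t) i + virtualControl φ c κ g i.castSucc (z t) +
        (z t).2.2 i := by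
      simp only [err, errOf]
      ring
    rw [hx]
    exact (abs_add_le _ _).trans (add_le_add ((abs_add_le _ _).trans
      (add_le_add (hMh t ht) (hC t ht))) ((PiLp.norm_apply_le _ i).trans (hMρ t ht)))

end Boundedness

section Safety

variable {φ : (i : Fin n) → EuclideanSpace ℝ (Fin (i + 1)) → EuclideanSpace ℝ (Fin p)}
  {c κ g : Fin n → ℝ} {r : ℝ → ℝ} {θ : EuclideanSpace ℝ (Fin p)} {tf : EReal}
  {x : ℝ → EuclideanSpace ℝ (Fin n)} {θhat : ℝ → EuclideanSpace ℝ (Fin p)} {T D c₀ : ℝ}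

/-- The effect of the disturbances on each single error equation is arbitrarily close to `D`, in
that all equations have common envelopes with values at most `D'` for every `D' > D`. The strict
inequality leaves the room which the square-root envelopes of square-integrable signals need. -/
def HasEnvelopesAbove
    (φ : (i : Fin n) → EuclideanSpace ℝ (Fin (i + 1)) → EuclideanSpace ℝ (Fin p))
    (c κ g : Fin n → ℝ) (r : ℝ → ℝ) (θ : EuclideanSpace ℝ (Fin p)) (tf : EReal)
    (x : ℝ → EuclideanSpace ℝ (Fin n)) (θhat : ℝ → EuclideanSpace ℝ (Fin p)) (D : ℝ) : Prop :=
  ∀ D' > D, ∀ T ∈ timeInterval tf, ∃ y,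
    IsEnvelope (fun i t => damping φ c κ g i (ptAt r x θhat t))
      (fun i t => |perturbation φ c κ g i θ (ptAt r x θhat t) (deriv θhat t)|) T D' y

theorem IsClosedLoop.mul_err_le_of_isEnvelope (hφ : ∀ i, ContDiff ℝ ∞ (φ i))
    (hr : IsReference n r) (hsol : IsClosedLoop φ c κ g r θ tf x θhat) (hT : T ∈ timeInterval tf)
    (hc₀ : 0 < c₀) (hle : ∀ i z, c₀ ≤ damping φ c κ g i z) {y : ℝ → ℝ}
    (hy : IsEnvelope (fun i t => damping φ c κ g i (ptAt r x θhat t))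
      (fun i t => |perturbation φ c κ g i θ (ptAt r x θhat t) (deriv θhat t)|) T D y)
    {σ : ℝ} (hσ : |σ| ≤ 1) {a : ℕ → ℝ} (ha : ∀ j, 0 ≤ a j) (i : Fin n)
    (hinit : ∀ j, σ * coordExtend (err φ c κ g (ptAt r x θhat 0)) 0 (i + j) ≤ a j) :
    ∀ t ∈ Icc 0 T, σ * err φ c κ g (ptAt r x θhat t) i ≤
      decay c₀ a (n - i) t + D * ∑ k ∈ Finset.range (n - i), c₀⁻¹ ^ k := by
  have h_coord : ∀ k (hk : k < n - i) t, coordExtend (err φ c κ g (ptAt r x θhat t)) 0 (i + k) =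
      err φ c κ g (ptAt r x θhat t) ⟨i + k, by omega⟩ := fun k hk t => coordExtend_of_lt (by omega)
  have h_cascade := cascade_le (m := n - i)
    (h := fun k t => σ * coordExtend (err φ c κ g (ptAt r x θhat t)) 0 (i + k)) hc₀
    (hy.nonneg_zero.trans (hy.le 0 ⟨le_rfl, hT.1⟩)) hy.absolutelyContinuous hy.nonneg_zero hy.le ha
    (fun k hk => ?_) (fun k _ => hinit k)
    (fun t _ => by rw [coordExtend_of_le (by omega), mul_zero]) fun k hk => ?_
  · intro t ht
    simpa only [add_zero, coordExtend_of_lt i.isLt] using h_cascade t ht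
  · simp only [h_coord k hk]
    exact (hsol.absolutelyContinuousOnInterval_err hφ hr hT _).const_mul σ
  · filter_upwards [hsol.ae_hasDerivAt_err hφ hr hT, hy.ae_le] with t hder hpert ht
    refine ⟨_, hle ⟨i + k, by omega⟩ (ptAt r x θhat t), ?_⟩
    simp only [h_coord k hk]
    rw [((hder ht ⟨i + k, by omega⟩).const_mul σ).deriv, ← add_assoc]
    have h_sign := (le_abs_self _).trans ((abs_mul σ _).trans_le
      ((mul_le_of_le_one_left (abs_nonneg _) hσ).trans (hpert ht ⟨i + k, by omega⟩)))
    linarith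

theorem IsClosedLoop.err_mem_Icc (hφ : ∀ i, ContDiff ℝ ∞ (φ i))
    (hr : IsReference n r) (hsol : IsClosedLoop φ c κ g r θ tf x θhat)
    (hc₀ : 0 < c₀) (hle : ∀ i z, c₀ ≤ damping φ c κ g i z)
    (henv : HasEnvelopesAbove φ c κ g r θ tf x θhat D)
    (hinit : ∀ k, 0 ≤ coordExtend (err φ c κ g (ptAt r x θhat 0)) 0 k)
    (i : Fin n) {t : ℝ} (ht : t ∈ timeInterval tf) :
    err φ c κ g (ptAt r x θhat t) i ∈ Icc (-(D * ∑ k ∈ Finset.range (n - i), c₀⁻¹ ^ k))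
      (decay c₀ (fun j => coordExtend (err φ c κ g (ptAt r x θhat 0)) 0 (i + j)) (n - i) t +
        D * ∑ k ∈ Finset.range (n - i), c₀⁻¹ ^ k) := by
  have h_bound : ∀ {σ : ℝ}, |σ| ≤ 1 → ∀ {a : ℕ → ℝ}, (∀ j, 0 ≤ a j) →
      (∀ j, σ * coordExtend (err φ c κ g (ptAt r x θhat 0)) 0 (i + j) ≤ a j) →
      σ * err φ c κ g (ptAt r x θhat t) i ≤
        decay c₀ a (n - i) t + D * ∑ k ∈ Finset.range (n - i), c₀⁻¹ ^ k := by
    intro σ hσ a ha ha_init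
    have h_lim : Tendsto
        (fun D' => decay c₀ a (n - i) t + D' * ∑ k ∈ Finset.range (n - i), c₀⁻¹ ^ k) (𝓝[>] D)
        (𝓝 (decay c₀ a (n - i) t + D * ∑ k ∈ Finset.range (n - i), c₀⁻¹ ^ k)) :=
      Continuous.continuousWithinAt (by fun_prop)
    refine ge_of_tendsto h_lim ?_
    filter_upwards [self_mem_nhdsWithin] with D' hD'
    obtain ⟨y, hy⟩ := henv D' hD' t ht
    exact hsol.mul_err_le_of_isEnvelope hφ hr ht hc₀ hle hy hσ ha i ha_init t ⟨ht.1, le_rfl⟩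
  have h_upper := h_bound (σ := 1) (by simp) (fun j => hinit (i + j)) fun j => (one_mul _).le
  have h_lower := h_bound (σ := -1) (by simp) (a := 0) (fun _ => le_rfl) fun j => by
    simpa using hinit (i + j)
  rw [one_mul] at h_upper
  simp only [decay, Pi.zero_apply, mul_zero, Finset.sum_const_zero, zero_add] at h_lower
  exact ⟨by linarith, h_upper⟩

theorem IsClosedLoop.safeBound_of_hasEnvelopesAbove (hn : 1 ≤ n) (hφ : ∀ i, ContDiff ℝ ∞ (φ i))
    (hr : IsReference n r) (hc : ∀ i, 0 < c i) (hκ : ∀ i, 0 ≤ κ i) (hg : ∀ i, 0 ≤ g i)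
    (hsol : IsClosedLoop φ c κ g r θ tf x θhat)
    (hgain : ∀ (i : Fin n) (hi : (i : ℕ) + 1 < n),
      gainLower φ c κ g (ptAt r x θhat 0) i hi ≤ (c i : EReal))
    (hinit : r 0 ≤ x 0 ⟨0, hn⟩) (hθ : ∃ M : ℝ, ∀ t ∈ timeInterval tf, ‖θhat t‖ ≤ M)
    (henv : HasEnvelopesAbove φ c κ g r θ tf x θhat D) :
    SafeBound hn c tf (fun t => err φ c κ g (ptAt r x θhat t)) x (geomFactor n (⨅ i, c i) * D) := by
  have : Nonempty (Fin n) := ⟨⟨0, hn⟩⟩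
  have hc₀ : 0 < ⨅ i, c i := ciInf_pos_of_finite hc
  have h_init : ∀ k, 0 ≤ coordExtend (err φ c κ g (ptAt r x θhat 0)) 0 k := by
    intro k
    unfold coordExtend
    split_ifs
    · exact err_nonneg hκ hg hgain (fun _ => by simpa [ptAt, refDeriv] using hinit) _
    · exact le_rfl
  have h_mem := fun i t (ht : t ∈ timeInterval tf) => hsol.err_mem_Icc hφ hr hc₀
    (fun i _ => (ciInf_le_of_finite c i).trans (le_damping (hκ i) (hg i))) henv h_init i ht
  have h_err : ∀ i, ∃ M : ℝ, ∀ t ∈ timeInterval tf, |err φ c κ g (ptAt r x θhat t) i| ≤ M := by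
    refine fun i => ⟨_, fun t ht => abs_le.2 ⟨?_, (h_mem i t ht).2.trans
      (add_le_add_left (decay_le_sum hc₀ (fun j => h_init (i + j)) ht.1) _)⟩⟩
    refine (neg_le_neg (le_add_of_nonneg_left ?_)).trans (h_mem i t ht).1
    exact Finset.sum_nonneg fun j _ => mul_nonneg (by positivity) (h_init _)
  obtain ⟨Mr, hMr⟩ := hr.bounded
  have h_ref : ∃ M : ℝ, ∀ t ∈ timeInterval tf, ‖(ptAt r x θhat t).2.2‖ ≤ M :=
    exists_norm_bound_of_coord fun k => ⟨Mr, fun t ht => hMr k k.isLt.le t ht.1⟩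
  have h_state := exists_bound_state (z := ptAt r x θhat) hφ hθ h_ref h_err
  refine ⟨exists_norm_bound_of_coord h_err, exists_norm_bound_of_coord h_state, fun t ht => ?_⟩
  have h_first := h_mem ⟨0, hn⟩ t ht
  rw [geomFactor_eq_sum hn hc₀, mul_comm _ D]
  simp only [decay, zero_add, Nat.sub_zero, ← Fin.sum_univ_eq_sum_range
    (fun j => t ^ j / (j.factorial : ℝ) * coordExtend (err φ c κ g (ptAt r x θhat 0)) 0 j),
    coordExtend_of_lt (Fin.isLt _)] at h_first
  exact h_first

end Safety

section Envelopes

variable {φ : (i : Fin n) → EuclideanSpace ℝ (Fin (i + 1)) → EuclideanSpace ℝ (Fin p)}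
  {c κ g : Fin n → ℝ} {r : ℝ → ℝ} {θ : EuclideanSpace ℝ (Fin p)} {tf : EReal}
  {x : ℝ → EuclideanSpace ℝ (Fin n)} {θhat : ℝ → EuclideanSpace ℝ (Fin p)} {T A B : ℝ}

theorem hasEnvelopesAbove_add
    (hA : ∀ T ∈ timeInterval tf, ∃ y, IsEnvelope (fun i t => damping φ c κ g i (ptAt r x θhat t))
      (fun i t => ‖regressor φ c κ g i (ptAt r x θhat t)‖ * ‖θ - θhat t‖) T A y)
    (hB : ∀ B' > B, ∀ T ∈ timeInterval tf, ∃ y,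
      IsEnvelope (fun i t => damping φ c κ g i (ptAt r x θhat t))
        (fun i t => ‖sensitivity φ c κ g i (ptAt r x θhat t)‖ * ‖deriv θhat t‖) T B' y) :
    HasEnvelopesAbove φ c κ g r θ tf x θhat (A + B) := by
  intro D' hD' T hT
  obtain ⟨y₁, hy₁⟩ := hA T hT
  obtain ⟨y₂, hy₂⟩ := hB (D' - A) (lt_sub_iff_add_lt'.2 hD') T hT
  exact ⟨_, (hy₁.add hy₂).mono (Eventually.of_forall fun t _ i => abs_perturbation_le θ _)
    (add_sub_cancel A D').le⟩

theorem isEnvelope_regressor (hc : ∀ i, 0 < c i) (hκ : ∀ i, 0 < κ i) (hg : ∀ i, 0 ≤ g i)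
    (hθ : MemLp (fun t => θ - θhat t) ⊤ (volume.restrict (timeInterval tf)))
    (hT : T ∈ timeInterval tf) :
    IsEnvelope (fun i t => damping φ c κ g i (ptAt r x θhat t))
      (fun i t => ‖regressor φ c κ g i (ptAt r x θhat t)‖ * ‖θ - θhat t‖) T
      (sigNorm ⊤ tf (fun t => θ - θhat t) / (2 * √((⨅ i, c i) * ⨅ i, κ i)))
      fun _ => sigNorm ⊤ tf (fun t => θ - θhat t) / (2 * √((⨅ i, c i) * ⨅ i, κ i)) := by
  refine isEnvelope_const (div_nonneg (sigNorm_nonneg _) (by positivity)) ?_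
  filter_upwards [ae_norm_le_sigNorm hθ hT] with t hθt ht i
  exact (mul_le_mul_of_nonneg_left (hθt ht) (norm_nonneg _)).trans
    (norm_regressor_mul_le hc hκ (hg i) (sigNorm_nonneg _))

theorem isEnvelope_sensitivity_of_eq_one (hn : n = 1) (hB : 0 ≤ B)
    (hs : ∀ i z, 0 ≤ damping φ c κ g i z) :
    IsEnvelope (fun i t => damping φ c κ g i (ptAt r x θhat t))
      (fun i t => ‖sensitivity φ c κ g i (ptAt r x θhat t)‖ * ‖deriv θhat t‖) T B fun _ => B := by
  refine isEnvelope_const hB (Eventually.of_forall fun t _ i => ?_)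
  rw [sensitivity_eq_zero (by omega), norm_zero, zero_mul]
  exact mul_nonneg hB (hs _ _)

theorem isEnvelope_sensitivity_top (hn : 1 < n) (hc : ∀ i, 0 < c i) (hκ : ∀ i, 0 ≤ κ i)
    (hg : ∀ i, 0 < g i) (hθ' : MemLp (deriv θhat) ⊤ (volume.restrict (timeInterval tf)))
    (hT : T ∈ timeInterval tf) :
    IsEnvelope (fun i t => damping φ c κ g i (ptAt r x θhat t))
      (fun i t => ‖sensitivity φ c κ g i (ptAt r x θhat t)‖ * ‖deriv θhat t‖) T
      (sigNorm ⊤ tf (deriv θhat) / (2 * √((⨅ i, c i) * minTail g)))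
      fun _ => sigNorm ⊤ tf (deriv θhat) / (2 * √((⨅ i, c i) * minTail g)) := by
  refine isEnvelope_const (div_nonneg (sigNorm_nonneg _) (by positivity)) ?_
  filter_upwards [ae_norm_le_sigNorm hθ' hT] with t hθt ht i
  exact (mul_le_mul_of_nonneg_left (hθt ht) (norm_nonneg _)).trans
    (norm_sensitivity_mul_le hn hc (hκ i) hg (sigNorm_nonneg _))

theorem exists_isEnvelope_sensitivity_two (hn : 1 < n) (hc : ∀ i, 0 ≤ c i) (hκ : ∀ i, 0 ≤ κ i)
    (hg : ∀ i, 0 < g i) (hθ' : MemLp (deriv θhat) 2 (volume.restrict (timeInterval tf)))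
    (hT : T ∈ timeInterval tf) (hB : sigNorm 2 tf (deriv θhat) / √(2 * minTail g) < B) :
    ∃ y, IsEnvelope (fun i t => damping φ c κ g i (ptAt r x θhat t))
      (fun i t => ‖sensitivity φ c κ g i (ptAt r x θhat t)‖ * ‖deriv θhat t‖) T B y := by
  have hγ : 0 < minTail g := minTail_pos hn hg
  have hB₀ : 0 ≤ B := (div_nonneg (sigNorm_nonneg _) (by positivity)).trans hB.le
  refine exists_isEnvelope_of_integral_sq_lt hγ hT.1 (fun i t => ?_)
    (intervalIntegrable_norm_sq hθ' hT) hB₀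
    ((integral_norm_sq_le_sigNorm_sq hθ' hT).trans_lt ?_)
  · exact (minTail_mul_sensitivity_sq_le.trans (le_add_of_nonneg_left (hc i))).trans
      (add_sensitivity_le_damping (hκ i))
  · have h_sq := pow_lt_pow_left₀ ((div_lt_iff₀ (by positivity)).1 hB) (sigNorm_nonneg 2)
      two_ne_zero
    rwa [mul_pow, Real.sq_sqrt (by positivity), mul_comm] at h_sq

theorem hasEnvelopesAbove_violationInf (hc : ∀ i, 0 < c i) (hκ : ∀ i, 0 < κ i)
    (hg : ∀ i, 0 < g i) (hθ : MemLp (fun t => θ - θhat t) ⊤ (volume.restrict (timeInterval tf)))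
    (hθ' : MemLp (deriv θhat) ⊤ (volume.restrict (timeInterval tf))) (hn : 1 ≤ n) :
    HasEnvelopesAbove φ c κ g r θ tf x θhat
      (sigNorm ⊤ tf (fun t => θ - θhat t) / (2 * √((⨅ i, c i) * ⨅ i, κ i)) +
        if n = 1 then 0 else sigNorm ⊤ tf (deriv θhat) / (2 * √((⨅ i, c i) * minTail g))) := by
  refine hasEnvelopesAbove_add
    (fun T hT => ⟨_, isEnvelope_regressor hc hκ (fun i => (hg i).le) hθ hT⟩)
    fun B' hB' T hT => ?_
  split_ifs at hB' with h_one
  · exact ⟨_, isEnvelope_sensitivity_of_eq_one h_one hB'.le fun i z =>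
      (hc i).le.trans (le_damping (hκ i).le (hg i).le)⟩
  · exact ⟨_, (isEnvelope_sensitivity_top (by omega) hc (fun i => (hκ i).le) hg hθ' hT).mono
      (Eventually.of_forall fun _ _ _ => le_rfl) hB'.le⟩

theorem hasEnvelopesAbove_violationTwo (hc : ∀ i, 0 < c i) (hκ : ∀ i, 0 < κ i)
    (hg : ∀ i, 0 < g i) (hθ : MemLp (fun t => θ - θhat t) ⊤ (volume.restrict (timeInterval tf)))
    (hθ' : MemLp (deriv θhat) 2 (volume.restrict (timeInterval tf))) (hn : 1 ≤ n) :
    HasEnvelopesAbove φ c κ g r θ tf x θhat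
      (sigNorm ⊤ tf (fun t => θ - θhat t) / (2 * √((⨅ i, c i) * ⨅ i, κ i)) +
        if n = 1 then 0 else sigNorm 2 tf (deriv θhat) / √(2 * minTail g)) := by
  refine hasEnvelopesAbove_add
    (fun T hT => ⟨_, isEnvelope_regressor hc hκ (fun i => (hg i).le) hθ hT⟩)
    fun B' hB' T hT => ?_
  split_ifs at hB' with h_one
  · exact ⟨_, isEnvelope_sensitivity_of_eq_one h_one hB'.le fun i z =>
      (hc i).le.trans (le_damping (hκ i).le (hg i).le)⟩
  · exact exists_isEnvelope_sensitivity_two (by omega) (fun i => (hc i).le) (fun i => (hκ i).le)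
      hg hθ' hT hB'

theorem IsClosedLoop.exists_bound_estimate (hsol : IsClosedLoop φ c κ g r θ tf x θhat)
    (hθ : MemLp (fun t => θ - θhat t) ⊤ (volume.restrict (timeInterval tf))) :
    ∃ M : ℝ, ∀ t ∈ timeInterval tf, ‖θhat t‖ ≤ M := by
  refine ⟨‖θ‖ + sigNorm ⊤ tf fun t => θ - θhat t, fun t ht => ?_⟩
  have h_tilde : ‖θ - θhat t‖ ≤ sigNorm ⊤ tf fun t => θ - θhat t :=
    norm_le_sigNorm hθ (fun T hT => continuousOn_const.sub
      ((hsol.θhat_ac T hT).continuousOn.mono Icc_subset_uIcc)) ht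
  calc ‖θhat t‖ = ‖θ - (θ - θhat t)‖ := by rw [sub_sub_cancel]
    _ ≤ ‖θ‖ + ‖θ - θhat t‖ := norm_sub_le _ _
    _ ≤ _ := add_le_add_right h_tilde _

end Envelopes

end Nonovershooting

end

open Nonovershooting in
theorem lemma1 {n p : ℕ} (hn : 1 ≤ n)
    (φ : (i : Fin n) → EuclideanSpace ℝ (Fin (i + 1)) → EuclideanSpace ℝ (Fin p))
    (hφ : ∀ i, ContDiff ℝ ∞ (φ i))
    (θ : EuclideanSpace ℝ (Fin p))
    (r : ℝ → ℝ) (hr : IsReference n r)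
    (c κ g : Fin n → ℝ) (hc : ∀ i, 0 < c i) (hκ : ∀ i, 0 < κ i) (hg : ∀ i, 0 < g i)
    (tf : EReal) (htf : 0 < tf)
    (x : ℝ → EuclideanSpace ℝ (Fin n)) (θhat : ℝ → EuclideanSpace ℝ (Fin p))
    (hsol : IsClosedLoop φ c κ g r θ tf x θhat)
    (hgain : ∀ (i : Fin n) (hi : (i : ℕ) + 1 < n),
      max (gainLower φ c κ g (ptAt r x θhat 0) i hi) 0 ≤ (c i : EReal))
    (hinit : r 0 ≤ x 0 ⟨0, hn⟩) :
    (MemLp (fun t => θ - θhat t) ⊤ (volume.restrict (timeInterval tf)) →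
      MemLp (deriv θhat) ⊤ (volume.restrict (timeInterval tf)) →
      SafeBound hn c tf (fun t => err φ c κ g (ptAt r x θhat t)) x
        (violationInf c κ g (sigNorm ⊤ tf fun t => θ - θhat t) (sigNorm ⊤ tf (deriv θhat)))) ∧
    (MemLp (fun t => θ - θhat t) ⊤ (volume.restrict (timeInterval tf)) →
      MemLp (deriv θhat) 2 (volume.restrict (timeInterval tf)) →
      SafeBound hn c tf (fun t => err φ c κ g (ptAt r x θhat t)) x
        (violationTwo c κ g (sigNorm ⊤ tf fun t => θ - θhat t) (sigNorm 2 tf (deriv θhat)))) := by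
  have h_gain : ∀ (i : Fin n) (hi : (i : ℕ) + 1 < n),
      gainLower φ c κ g (ptAt r x θhat 0) i hi ≤ (c i : EReal) :=
    fun i hi => (le_max_left _ _).trans (hgain i hi)
  have h_safe {D : ℝ} (hθ : MemLp (fun t => θ - θhat t) ⊤ (volume.restrict (timeInterval tf)))
      (henv : HasEnvelopesAbove φ c κ g r θ tf x θhat D) :
      SafeBound hn c tf (fun t => err φ c κ g (ptAt r x θhat t)) x (geomFactor n (⨅ i, c i) * D) :=
    hsol.safeBound_of_hasEnvelopesAbove hn hφ hr hc (fun i => (hκ i).le) (fun i => (hg i).le)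
      h_gain hinit (hsol.exists_bound_estimate hθ) henv
  exact ⟨fun hθ hθ' => h_safe hθ (hasEnvelopesAbove_violationInf hc hκ hg hθ hθ' hn),
    fun hθ hθ' => h_safe hθ (hasEnvelopesAbove_violationTwo hc hκ hg hθ hθ' hn)⟩
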